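/- Let $d\ge 2$. The Gaussian double-well model on $\mathbb Z^d$ in its Ising-spin representation has spins $S_x=(\phi_x,\sigma_x)\in\mathbb R\times\{-1,+1\}$, $x\in\mathbb Z^d$, with a priori law (Lebesgue measure)$\,\times\,$(counting measure), and, for parameters $\beta,\kappa>0$, the formal Hamiltonian $$\beta H(\phi,\sigma)=\beta\sum_{\langle x,y\rangle}(\phi_x-\phi_y)^2+\frac\kappa2\sum_x\phi_x^2-\kappa\sum_x\phi_x\sigma_x ,$$ where the first sum runs over unordered nearest-neighbour pairs. For finite $\Lambda\subset\mathbb Z^d$ let $\beta H_\Lambda$ consist of the pair terms with $\{x,y\}\cap\Lambda\neq\emptyset$ and the site terms with $x\in\Lambda$; the finite-volume Gibbs measure in $\Lambda$ with boundary condition $S_{\Lambda^c}$ is the probability measure proportional to $e^{-\beta H_\Lambda(\phi,\sigma)}\prod_{x\in\Lambda}d\phi_x$ (with counting measure in $\sigma_\Lambda$). Let $\mathfrak G_{\beta,\kappa}$ be the set of infinite-volume (DLR) Gibbs measures, i.e. of probability measures $\mu$ on $(\mathbb R\times\{-1,+1\})^{\mathbb Z^d}$ such that for every finite $\Lambda$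 and $\mu$-a.e. $S_{\Lambda^c}$ the conditional law of $S_\Lambda$ given $S_{\Lambda^c}$ is the finite-volume Gibbs measure in $\Lambda$ with boundary condition $S_{\Lambda^c}$. Theorem. For each $\epsilon>0$ there is $c>0$ (depending only on $d$ and $\epsilon$) such that whenever $\beta>c$, $\kappa>c$ and $\kappa/\beta>c$, there exist two distinct translation-invariant measures $\mu^+,\mu^-\in\mathfrak G_{\beta,\kappa}$ such that, for all $x\in\mathbb Z^d$, $$\mu^\pm(\sigma_x=\pm1)\ge 1-\epsilon\qquad\text{and}\qquad E_{\mu^\pm}\bigl((\phi_x\mp1)^2\bigr)\le\epsilon .$$ -/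

import Mathlib

open MeasureTheory ProbabilityTheory

noncomputable section

namespace GaussianDoubleWell

/-- The vertices of the hypercubic lattice. -/
abbrev Site (d : ℕ) : Type := Fin d → ℤ

/-- The spin at a site is a pair `(φ, σ)` with `φ` real and `σ` one of the two signs `1`, `-1`
(the two units of the ring of integers). -/
abbrev Spin : Type := ℝ × ℤˣ

/-- Spin configurations on the whole lattice, with the product sigma-algebra. -/
abbrev Config (d : ℕ) : Type := Site d → Spin

/-- The field `φ_x`. -/
def phi {d : ℕ} (S : Config d) (x : Site d) : ℝ := (S x).1

/-- The Ising spin `σ_x`. -/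
def sigma {d : ℕ} (S : Config d) (x : Site d) : ℤˣ := (S x).2

/-- The `i`-th coordinate unit vector of the lattice. -/
def unitVec {d : ℕ} (i : Fin d) : Site d := Pi.single i 1

/-- Every nearest-neighbour pair is `{x, x + unitVec i}` for exactly one `x` and one `i`. This is the
finite set of those `x` for which the pair in direction `i` based at `x` has at least one endpoint
in `Λ`. -/
def bondBases {d : ℕ} (Λ : Finset (Site d)) (i : Fin d) : Finset (Site d) :=
  Λ ∪ Λ.image (fun x => x - unitVec i)

/-- The energy `β H_Λ(φ, σ)` in a finite volume `Λ`: the sum of `β (φ_x - φ_y) ^ 2` over all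
unordered nearest-neighbour pairs that meet `Λ`, and of `κ / 2 * φ_x ^ 2 - κ * φ_x * σ_x` over all
sites of `Λ`. Up to the constant `κ / 2`, the latter is `κ / 2 * (φ_x - σ_x) ^ 2`. -/
def energy {d : ℕ} (β κ : ℝ) (Λ : Finset (Site d)) (S : Config d) : ℝ :=
  β * (∑ i : Fin d, ∑ x ∈ bondBases Λ i, (phi S x - phi S (x + unitVec i)) ^ 2)
    + κ / 2 * (∑ x ∈ Λ, phi S x ^ 2)
    - κ * (∑ x ∈ Λ, phi S x * ((sigma S x : ℤ) : ℝ))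

/-- The configuration that equals `s` in `Λ` and `η` outside `Λ`. -/
def glue {d : ℕ} (Λ : Finset (Site d)) (s : Λ → Spin) (η : Config d) : Config d :=
  fun x => if h : x ∈ Λ then s ⟨x, h⟩ else η x

/-- The a priori law of one spin: Lebesgue measure times counting measure on the two signs. -/
def aPriori : Measure Spin := (volume : Measure ℝ).prod Measure.count

/-- The unnormalised Boltzmann weight on the spins in `Λ`, with boundary condition `η`. -/
def weight {d : ℕ} (β κ : ℝ) (Λ : Finset (Site d)) (η : Config d) : Measure (Λ → Spin) :=
  (Measure.pi fun _ : Λ => aPriori).withDensity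
    fun s => ENNReal.ofReal (Real.exp (-energy β κ Λ (glue Λ s η)))

/-- The finite-volume partition function. -/
def partitionFunction {d : ℕ} (β κ : ℝ) (Λ : Finset (Site d)) (η : Config d) : ENNReal :=
  weight β κ Λ η Set.univ

/-- The finite-volume Gibbs measure in `Λ` with boundary condition `η`, regarded as the law of the
configuration on the whole lattice that coincides with `η` outside `Λ`. -/
def finiteGibbs {d : ℕ} (β κ : ℝ) (Λ : Finset (Site d)) (η : Config d) : Measure (Config d) :=
  (partitionFunction β κ Λ η)⁻¹ • (weight β κ Λ η).map (fun s => glue Λ s η)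

/-- Infinite-volume Gibbs measures (the DLR condition): for each finite `Λ`, the conditional law of
the configuration given the spins outside `Λ` is the finite-volume Gibbs measure in `Λ` whose
boundary condition is the configuration outside `Λ`. -/
structure IsGibbs {d : ℕ} (β κ : ℝ) (μ : Measure (Config d)) : Prop where
  isProbabilityMeasure : IsProbabilityMeasure μ
  dlr : ∀ (Λ : Finset (Site d)) (A : Set (Config d)), MeasurableSet A →
    μ[A.indicator (fun _ => (1 : ℝ)) | cylinderEvents ((Λ : Set (Site d))ᶜ)]
      =ᵐ[μ] fun η => (finiteGibbs β κ Λ η).real A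

/-- The shift of a configuration by a lattice vector. -/
def shift {d : ℕ} (a : Site d) (S : Config d) : Config d := fun y => S (y - a)

/-- Invariance of a measure under all lattice shifts. -/
def TranslationInvariant {d : ℕ} (μ : Measure (Config d)) : Prop :=
  ∀ a : Site d, μ.map (shift a) = μ

end GaussianDoubleWell

end

/-!
The plus phase is obtained from a Peierls argument carried out directly for the pair `(φ, σ)`.

*Flipping a contour.* Let `B` be a finite set of sites. Replacing `(φ, σ)` by `(-φ, -σ)` on `B`
preserves the a priori measure and changes the energy exactly by `4 β ∑ φ_x φ_y` over the bonds of
the edge boundary of `B` (`energy_flipOn`). On the event that the Ising spins disagree along all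
these bonds, `φ_x φ_y` is `-1` up to the deviations `φ_x - σ_x`, so that the flip multiplies the
Boltzmann factor by about `exp (3 β |∂B|)` unless these deviations are large. Hence the event has
probability at most `2 exp (-2 β |∂B|)` (`gint_contourEvent_le`), once the second moments of the
deviations on the event are known to be a small multiple of its probability.

*Second moments.* Given all other spins and its own sign, `φ_x` is Gaussian with variance
`1 / (κ + 4 d β)`, and its mean differs from `σ_x` by `2 β / (κ + 4 d β)` times a sum over the
neighbours of `φ_y - σ_x` (`gint_singleton_dev_sq_le`). So the second moment of `φ_x - σ_x` is at
most `1 / κ + O((β / κ) ^ 2)` plus a small multiple of the second moments at the neighbours, and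
evaluating this at a site of the box where the second moment is largest bounds it everywhere
(`gint_dev_sq_le`). The argument is insensitive to conditioning on events of the Ising spins.

*Contours.* A contour is a set of bonds that is connected through plaquettes. That every minus spin
is surrounded by a connected part of the boundary of the set of minus spins follows from the
exactness of closed `ZMod 2`-valued one-cochains on the lattice (`exists_lattice_primitive`): a part
of a boundary that is closed under passing to nearby bonds of that boundary meets each plaquette in
an even number of bonds, and is therefore itself a boundary. Connected sets of `n` bonds are ranges
of walks with `2 (n - 1)` steps, so there are exponentially many of them, and the Peierls sum is
small for large `β` (`gint_sigma_eq_neg_one_le`).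

*Infinite volume.* The finite-volume measures with plus boundary conditions, averaged over
translations, are tight by the second moment bound, almost invariant under translations, and
preserved by the Gibbs kernels of smaller volumes. Those kernels are Feller, because the range of
the interaction is finite and the Boltzmann factors are dominated uniformly in the boundary
condition. So any weak limit point is a translation-invariant Gibbs measure that satisfies the same
bounds (`exists_plus_phase`). The minus phase is its image under `(φ, σ) ↦ (-φ, -σ)`.
-/

noncomputable section

namespace GaussianDoubleWell

open scoped ENNReal

variable {d : ℕ}

/-! ### Finite-volume Gibbs kernels -/

instance : MeasurableSingletonClass ℤˣ where
  measurableSet_singleton u := by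
    have : ({u} : Set ℤˣ) = Units.val ⁻¹' {(u : ℤ)} := by
      ext v; simp [Units.ext_iff]
    rw [this]
    exact ⟨_, measurableSet_singleton _, rfl⟩

instance : SigmaFinite aPriori := by unfold aPriori; infer_instance


lemma glue_eq_updateFinset (Λ : Finset (Site d)) (s : Λ → Spin) (η : Config d) :
    glue Λ s η = Function.updateFinset η Λ s := by
  ext x : 1
  simp only [glue, Function.updateFinset]

lemma measurable_glue (Λ : Finset (Site d)) (η : Config d) :
    Measurable fun s : Λ → Spin => glue Λ s η := by
  simp only [glue_eq_updateFinset]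
  exact measurable_updateFinset

@[fun_prop]
lemma measurable_phi (x : Site d) : Measurable fun S : Config d => phi S x :=
  measurable_fst.comp (measurable_pi_apply x)

@[fun_prop]
lemma measurable_sigma (x : Site d) : Measurable fun S : Config d => sigma S x :=
  measurable_snd.comp (measurable_pi_apply x)

@[fun_prop]
lemma measurable_sigmaReal (x : Site d) :
    Measurable fun S : Config d => ((sigma S x : ℤ) : ℝ) :=
  (Measurable.of_discrete (f := fun u : ℤˣ => ((u : ℤ) : ℝ))).comp (measurable_sigma x)

@[fun_prop]
lemma measurable_energy (β κ : ℝ) (Λ : Finset (Site d)) :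
    Measurable fun S : Config d => energy β κ Λ S := by
  unfold energy
  fun_prop

/-- The Boltzmann factor `exp (-β H_Λ)`. -/
def boltz (β κ : ℝ) (Λ : Finset (Site d)) (S : Config d) : ℝ≥0∞ :=
  ENNReal.ofReal (Real.exp (-energy β κ Λ S))

@[fun_prop]
lemma measurable_boltz (β κ : ℝ) (Λ : Finset (Site d)) : Measurable (boltz (d := d) β κ Λ) := by
  unfold boltz
  fun_prop

lemma boltz_ne_zero (β κ : ℝ) (Λ : Finset (Site d)) (S : Config d) : boltz β κ Λ S ≠ 0 := by
  simp [boltz, Real.exp_pos]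

/-- The unnormalised Gibbs integral of `f` over the spins in `Λ`, as a function of the boundary
condition. -/
def gint (β κ : ℝ) (Λ : Finset (Site d)) (f : Config d → ℝ≥0∞) : Config d → ℝ≥0∞ :=
  lmarginal (fun _ => aPriori) Λ fun S => f S * boltz β κ Λ S

lemma measurable_gint (β κ : ℝ) (Λ : Finset (Site d)) {f : Config d → ℝ≥0∞} (hf : Measurable f) :
    Measurable (gint β κ Λ f) :=
  Measurable.lmarginal _ (hf.mul (measurable_boltz β κ Λ))

lemma gint_congr_boundary (β κ : ℝ) (Λ : Finset (Site d)) (f : Config d → ℝ≥0∞)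
    {η η' : Config d} (h : ∀ x ∉ Λ, η x = η' x) : gint β κ Λ f η = gint β κ Λ f η' :=
  lmarginal_congr _ _ h

lemma lintegral_weight (β κ : ℝ) (Λ : Finset (Site d)) (η : Config d) {f : Config d → ℝ≥0∞}
    (hf : Measurable f) : ∫⁻ s, f (glue Λ s η) ∂weight β κ Λ η = gint β κ Λ f η := by
  unfold weight gint lmarginal
  have hb : Measurable fun s => ENNReal.ofReal (Real.exp (-energy β κ Λ (glue Λ s η))) :=
    (measurable_boltz β κ Λ).comp (measurable_glue Λ η)
  have hfg : Measurable fun s => f (glue Λ s η) := hf.comp (measurable_glue Λ η)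
  rw [lintegral_withDensity_eq_lintegral_mul _ hb hfg]
  refine lintegral_congr fun s => ?_
  simp only [Pi.mul_apply, boltz, glue_eq_updateFinset]
  rw [mul_comm]

lemma partitionFunction_eq (β κ : ℝ) (Λ : Finset (Site d)) (η : Config d) :
    partitionFunction β κ Λ η = gint β κ Λ 1 η := by
  rw [← lintegral_weight β κ Λ η measurable_one, partitionFunction]
  simp

lemma lintegral_finiteGibbs (β κ : ℝ) (Λ : Finset (Site d)) (η : Config d) {f : Config d → ℝ≥0∞}
    (hf : Measurable f) :
    ∫⁻ S, f S ∂finiteGibbs β κ Λ η = (gint β κ Λ 1 η)⁻¹ * gint β κ Λ f η := by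
  rw [finiteGibbs, lintegral_smul_measure, lintegral_map hf (measurable_glue Λ η),
    lintegral_weight β κ Λ η hf, partitionFunction_eq, smul_eq_mul]

lemma measurable_lintegral_finiteGibbs (β κ : ℝ) (Λ : Finset (Site d)) {f : Config d → ℝ≥0∞}
    (hf : Measurable f) : Measurable fun η => ∫⁻ S, f S ∂finiteGibbs β κ Λ η := by
  simp only [lintegral_finiteGibbs β κ Λ _ hf]
  exact (measurable_gint β κ Λ measurable_one).inv.mul (measurable_gint β κ Λ hf)

lemma lintegral_finiteGibbs_congr (β κ : ℝ) (Λ : Finset (Site d)) {f : Config d → ℝ≥0∞}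
    (hf : Measurable f) {η η' : Config d} (h : ∀ x ∉ Λ, η x = η' x) :
    ∫⁻ S, f S ∂finiteGibbs β κ Λ η = ∫⁻ S, f S ∂finiteGibbs β κ Λ η' := by
  rw [lintegral_finiteGibbs _ _ _ _ hf, lintegral_finiteGibbs _ _ _ _ hf,
    gint_congr_boundary β κ Λ f h, gint_congr_boundary β κ Λ 1 h]

lemma unit_sq (u : ℤˣ) : ((u : ℤ) : ℝ) ^ 2 = 1 := by
  rcases Int.units_eq_one_or u with rfl | rfl <;> simp

lemma energy_ge {β κ : ℝ} (hβ : 0 ≤ β) (Λ : Finset (Site d)) (S : Config d) :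
    ∑ x ∈ Λ, (κ / 2 * (phi S x - ((sigma S x : ℤ) : ℝ)) ^ 2 - κ / 2) ≤ energy β κ Λ S := by
  have h1 : ∑ x ∈ Λ, (κ / 2 * (phi S x - ((sigma S x : ℤ) : ℝ)) ^ 2 - κ / 2)
      = κ / 2 * (∑ x ∈ Λ, phi S x ^ 2) - κ * (∑ x ∈ Λ, phi S x * ((sigma S x : ℤ) : ℝ)) := by
    rw [Finset.mul_sum, Finset.mul_sum, ← Finset.sum_sub_distrib]
    refine Finset.sum_congr rfl fun x _ => ?_
    linear_combination (κ / 2) * unit_sq (sigma S x)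
  have h2 : 0 ≤ β * (∑ i : Fin d, ∑ x ∈ bondBases Λ i, (phi S x - phi S (x + unitVec i)) ^ 2) := by
    positivity
  rw [h1, energy]
  linarith

/-- The one-site function whose product over the sites dominates the Boltzmann factor uniformly in
the boundary condition, with a quadratic factor to spare. -/
def siteBound (κ : ℝ) (s : Spin) : ℝ≥0∞ :=
  ENNReal.ofReal ((1 + (s.1 - ((s.2 : ℤ) : ℝ)) ^ 2) *
    Real.exp (κ / 2 - κ / 2 * (s.1 - ((s.2 : ℤ) : ℝ)) ^ 2))

lemma measurable_siteBound (κ : ℝ) : Measurable (siteBound κ) := by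
  have : Measurable fun s : Spin => ((s.2 : ℤ) : ℝ) :=
    (Measurable.of_discrete (f := fun u : ℤˣ => ((u : ℤ) : ℝ))).comp measurable_snd
  unfold siteBound
  fun_prop

lemma lintegral_aPriori {f : Spin → ℝ≥0∞} (hf : Measurable f) :
    ∫⁻ s, f s ∂aPriori = ∑ u : ℤˣ, ∫⁻ t : ℝ, f (t, u) := by
  rw [aPriori, lintegral_prod_symm _ hf.aemeasurable, lintegral_count, tsum_fintype]

lemma lintegral_siteBound_lt_top {κ : ℝ} (hκ : 0 < κ) : ∫⁻ s, siteBound κ s ∂aPriori < ∞ := by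
  rw [lintegral_aPriori (measurable_siteBound κ), ENNReal.sum_lt_top]
  intro u _
  have h0 : Integrable fun t : ℝ => Real.exp (-(κ / 2) * t ^ 2) :=
    integrable_exp_neg_mul_sq (by positivity)
  have h2 : Integrable fun t : ℝ => t ^ 2 * Real.exp (-(κ / 2) * t ^ 2) := by
    have := integrable_rpow_mul_exp_neg_mul_sq (b := κ / 2) (by positivity) (s := 2) (by norm_num)
    simpa using this
  have h : Integrable fun t : ℝ => (1 + (t - ((u : ℤ) : ℝ)) ^ 2) *
      Real.exp (κ / 2 - κ / 2 * (t - ((u : ℤ) : ℝ)) ^ 2) := by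
    refine (((h0.add h2).const_mul (Real.exp (κ / 2))).comp_sub_right ((u : ℤ) : ℝ)).congr ?_
    refine Filter.Eventually.of_forall fun t => ?_
    simp only [Pi.add_apply]
    rw [sub_eq_add_neg (κ / 2), Real.exp_add]
    ring_nf
  exact h.lintegral_lt_top

/-- The Boltzmann factor, even multiplied by `1 + (φ_x - σ_x) ^ 2` for all `x ∈ Λ`, is dominated
by a product of one-site functions. -/
lemma prod_mul_boltz_le {β κ : ℝ} (hβ : 0 ≤ β) (Λ : Finset (Site d)) (S : Config d) :
    ENNReal.ofReal (∏ x ∈ Λ, (1 + (phi S x - ((sigma S x : ℤ) : ℝ)) ^ 2)) * boltz β κ Λ S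
      ≤ ∏ x ∈ Λ, siteBound κ (S x) := by
  unfold siteBound boltz
  rw [← ENNReal.ofReal_mul (by positivity),
    ← ENNReal.ofReal_prod_of_nonneg (fun _ _ => by positivity)]
  refine ENNReal.ofReal_le_ofReal ?_
  rw [Finset.prod_mul_distrib, ← Real.exp_sum]
  gcongr ?_ * ?_
  · exact le_rfl
  · rw [Real.exp_le_exp, neg_le, ← Finset.sum_neg_distrib]
    refine le_trans (le_of_eq (Finset.sum_congr rfl fun x _ => ?_)) (energy_ge hβ Λ S)
    simp only [phi, sigma]
    ring

lemma lmarginal_prod_eq_pow {g : Spin → ℝ≥0∞} (hg : Measurable g) (Λ : Finset (Site d)) :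
    lmarginal (fun _ => aPriori) Λ (fun S : Config d => ∏ x ∈ Λ, g (S x))
      = fun _ => (∫⁻ s, g s ∂aPriori) ^ Λ.card := by
  induction Λ using Finset.induction_on with
  | empty => simp
  | insert a Λ ha ih =>
    rw [lmarginal_insert' _ (by fun_prop) ha]
    have : (fun S : Config d => ∫⁻ s, ∏ x ∈ insert a Λ, g (Function.update S a s x) ∂aPriori)
        = fun S => (∫⁻ s, g s ∂aPriori) * ∏ x ∈ Λ, g (S x) := by
      ext S
      rw [← lintegral_mul_const _ hg]
      refine lintegral_congr fun s => ?_
      rw [Finset.prod_insert ha, Function.update_self]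
      congr 1
      refine Finset.prod_congr rfl fun x hx => ?_
      rw [Function.update_of_ne (ne_of_mem_of_not_mem hx ha)]
    rw [this, Finset.card_insert_of_notMem ha, pow_succ']
    ext η
    rw [← congrFun ih η]
    unfold lmarginal
    rw [lintegral_const_mul]
    have : Measurable fun S : Config d => ∏ x ∈ Λ, g (S x) := by fun_prop
    exact this.comp measurable_updateFinset

lemma lmarginal_prod_siteBound_lt_top {κ : ℝ} (hκ : 0 < κ) (Λ : Finset (Site d)) (η : Config d) :
    lmarginal (fun _ => aPriori) Λ (fun S : Config d => ∏ x ∈ Λ, siteBound κ (S x)) η < ∞ := by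
  rw [lmarginal_prod_eq_pow (measurable_siteBound κ)]
  exact ENNReal.pow_lt_top (lintegral_siteBound_lt_top hκ)

lemma gint_lt_top {β κ : ℝ} (hβ : 0 ≤ β) (hκ : 0 < κ) (Λ : Finset (Site d)) (η : Config d)
    {f : Config d → ℝ≥0∞}
    (hf : ∀ S, f S ≤ ENNReal.ofReal (∏ x ∈ Λ, (1 + (phi S x - ((sigma S x : ℤ) : ℝ)) ^ 2))) :
    gint β κ Λ f η < ∞ := by
  refine lt_of_le_of_lt (lmarginal_mono (fun S => ?_) η) (lmarginal_prod_siteBound_lt_top hκ Λ η)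
  exact (mul_le_mul_left (hf S) _).trans (prod_mul_boltz_le hβ Λ S)

lemma one_le_prod_one_add_sq (Λ : Finset (Site d)) (S : Config d) :
    1 ≤ ∏ x ∈ Λ, (1 + (phi S x - ((sigma S x : ℤ) : ℝ)) ^ 2) :=
  Finset.one_le_prod fun x _ => by
    linarith [sq_nonneg (phi S x - ((sigma S x : ℤ) : ℝ))]

lemma gint_one_ne_top {β κ : ℝ} (hβ : 0 ≤ β) (hκ : 0 < κ) (Λ : Finset (Site d)) (η : Config d) :
    gint β κ Λ 1 η ≠ ∞ := by
  refine (gint_lt_top hβ hκ Λ η fun S => ?_).ne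
  rw [Pi.one_apply, ENNReal.one_le_ofReal]
  exact one_le_prod_one_add_sq Λ S

lemma gint_one_ne_zero (β κ : ℝ) (Λ : Finset (Site d)) (η : Config d) :
    gint β κ Λ 1 η ≠ 0 := by
  unfold gint lmarginal
  rw [Ne, lintegral_eq_zero_iff (by
    simp only [Pi.one_apply, one_mul]
    exact (measurable_boltz β κ Λ).comp measurable_updateFinset)]
  intro h
  have h2 : ∀ᵐ _s ∂(Measure.pi fun _ : Λ => aPriori), False := by
    filter_upwards [h] with s hs
    simp only [Pi.one_apply, one_mul, Pi.zero_apply] at hs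
    exact boltz_ne_zero _ _ _ _ hs
  rw [Filter.eventually_false_iff_eq_bot, ae_eq_bot, ← Measure.measure_univ_eq_zero,
    Measure.pi_univ, Finset.prod_eq_zero_iff] at h2
  obtain ⟨_, -, h3⟩ := h2
  rw [aPriori, ← Set.univ_prod_univ, Measure.prod_prod] at h3
  simp at h3

lemma isProbabilityMeasure_finiteGibbs {β κ : ℝ} (hβ : 0 ≤ β) (hκ : 0 < κ) (Λ : Finset (Site d))
    (η : Config d) : IsProbabilityMeasure (finiteGibbs β κ Λ η) := by
  constructor
  rw [← lintegral_one]
  change ∫⁻ S, (1 : Config d → ℝ≥0∞) S ∂_ = 1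
  rw [lintegral_finiteGibbs β κ Λ η measurable_one]
  exact ENNReal.inv_mul_cancel (gint_one_ne_zero β κ Λ η) (gint_one_ne_top hβ hκ Λ η)

/-- For `Δ ⊆ Λ`, the energy in `Λ` exceeds the one in `Δ` by an amount that does not depend on the
spins in `Δ`. -/
lemma energy_sub_energy_congr (β κ : ℝ) {Δ Λ : Finset (Site d)} (h : Δ ⊆ Λ) {S S' : Config d}
    (hS : ∀ x ∉ Δ, S x = S' x) :
    energy β κ Λ S - energy β κ Δ S = energy β κ Λ S' - energy β κ Δ S' := by
  have hphi : ∀ x ∉ Δ, phi S x = phi S' x := fun x hx => by simp [phi, hS x hx]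
  have hsig : ∀ x ∉ Δ, sigma S x = sigma S' x := fun x hx => by simp [sigma, hS x hx]
  have hbond : ∀ i : Fin d, bondBases Δ i ⊆ bondBases Λ i := fun i =>
    Finset.union_subset_union h (Finset.image_subset_image h)
  have key : ∀ T : Config d, energy β κ Λ T - energy β κ Δ T =
      β * (∑ i : Fin d, ∑ x ∈ bondBases Λ i \ bondBases Δ i,
        (phi T x - phi T (x + unitVec i)) ^ 2)
      + κ / 2 * (∑ x ∈ Λ \ Δ, phi T x ^ 2)
      - κ * (∑ x ∈ Λ \ Δ, phi T x * ((sigma T x : ℤ) : ℝ)) := by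
    intro T
    have h1 : ∑ i : Fin d, ∑ x ∈ bondBases Λ i, (phi T x - phi T (x + unitVec i)) ^ 2
        = ∑ i : Fin d, ∑ x ∈ bondBases Λ i \ bondBases Δ i, (phi T x - phi T (x + unitVec i)) ^ 2
          + ∑ i : Fin d, ∑ x ∈ bondBases Δ i, (phi T x - phi T (x + unitVec i)) ^ 2 := by
      rw [← Finset.sum_add_distrib]
      exact Finset.sum_congr rfl fun i _ => (Finset.sum_sdiff (hbond i)).symm
    simp only [energy, h1, ← Finset.sum_sdiff h]
    ring
  have e1 : ∑ i : Fin d, ∑ x ∈ bondBases Λ i \ bondBases Δ i, (phi S x - phi S (x + unitVec i)) ^ 2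
      = ∑ i : Fin d, ∑ x ∈ bondBases Λ i \ bondBases Δ i,
        (phi S' x - phi S' (x + unitVec i)) ^ 2 := by
    refine Finset.sum_congr rfl fun i _ => Finset.sum_congr rfl fun x hx => ?_
    simp only [bondBases, Finset.mem_sdiff, Finset.mem_union, Finset.mem_image, not_or,
      not_exists, not_and] at hx
    rw [hphi x hx.2.1, hphi (x + unitVec i) fun hmem => hx.2.2 _ hmem (by simp)]
  have e2 : ∑ x ∈ Λ \ Δ, phi S x ^ 2 = ∑ x ∈ Λ \ Δ, phi S' x ^ 2 :=
    Finset.sum_congr rfl fun x hx => by rw [hphi x (Finset.mem_sdiff.1 hx).2]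
  have e3 : ∑ x ∈ Λ \ Δ, phi S x * ((sigma S x : ℤ) : ℝ)
      = ∑ x ∈ Λ \ Δ, phi S' x * ((sigma S' x : ℤ) : ℝ) :=
    Finset.sum_congr rfl fun x hx => by
      rw [hphi x (Finset.mem_sdiff.1 hx).2, hsig x (Finset.mem_sdiff.1 hx).2]
  rw [key S, key S', e1, e2, e3]

lemma boltz_eq_mul (β κ : ℝ) {Δ Λ : Finset (Site d)} (h : Δ ⊆ Λ) (S : Config d) (s : Δ → Spin) :
    boltz β κ Λ (Function.updateFinset S Δ s)
      = ENNReal.ofReal (Real.exp (energy β κ Δ S - energy β κ Λ S))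
        * boltz β κ Δ (Function.updateFinset S Δ s) := by
  unfold boltz
  rw [← ENNReal.ofReal_mul (Real.exp_pos _).le, ← Real.exp_add]
  have := energy_sub_energy_congr β κ h (S := S) (S' := Function.updateFinset S Δ s)
    (fun x hx => by simp [Function.updateFinset, hx])
  congr 2
  linarith

/-- Integrating over the spins of a smaller volume `Δ ⊆ Λ` against the Boltzmann factor of `Λ`
amounts, up to a factor that does not involve them, to integrating against that of `Δ`. -/
lemma lmarginal_mul_boltz (β κ : ℝ) {Δ Λ : Finset (Site d)} (h : Δ ⊆ Λ) {f : Config d → ℝ≥0∞}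
    (hf : Measurable f) (S : Config d) :
    lmarginal (fun _ => aPriori) Δ (fun S => f S * boltz β κ Λ S) S
      = ENNReal.ofReal (Real.exp (energy β κ Δ S - energy β κ Λ S)) * gint β κ Δ f S := by
  unfold gint lmarginal
  rw [← lintegral_const_mul]
  · refine lintegral_congr fun s => ?_
    dsimp only
    rw [boltz_eq_mul β κ h]
    ring
  · exact (hf.mul (measurable_boltz β κ Δ)).comp measurable_updateFinset

/-- A tower property: in a Gibbs integral over `Λ`, the integral over the spins of a smaller
volume `Δ` may be done first, with the Boltzmann factor of `Δ`. -/
lemma gint_eq_lmarginal_sdiff (β κ : ℝ) {Δ Λ : Finset (Site d)} (h : Δ ⊆ Λ) {f : Config d → ℝ≥0∞}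
    (hf : Measurable f) :
    gint β κ Λ f = lmarginal (fun _ => aPriori) (Λ \ Δ) fun S =>
      ENNReal.ofReal (Real.exp (energy β κ Δ S - energy β κ Λ S)) * gint β κ Δ f S := by
  have hm : Measurable fun S => f S * boltz β κ Λ S := hf.mul (measurable_boltz β κ _)
  have hu := lmarginal_union (fun _ : Site d => aPriori) _ hm
    (Finset.sdiff_disjoint (s := Δ) (t := Λ))
  rw [Finset.sdiff_union_of_subset h] at hu
  rw [gint, hu]
  congr 1
  ext S
  rw [lmarginal_mul_boltz β κ h hf]

lemma gint_mono_of_subset (β κ : ℝ) {Δ Λ : Finset (Site d)} (h : Δ ⊆ Λ) {f g : Config d → ℝ≥0∞}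
    (hf : Measurable f) (hg : Measurable g) (hfg : ∀ S, gint β κ Δ f S ≤ gint β κ Δ g S)
    (η : Config d) : gint β κ Λ f η ≤ gint β κ Λ g η := by
  rw [gint_eq_lmarginal_sdiff β κ h hf, gint_eq_lmarginal_sdiff β κ h hg]
  refine lmarginal_mono (fun S => ?_) η
  exact mul_le_mul_right (hfg S) _

/-- Functions that do not depend on the spins in `Λ` factor out of Gibbs integrals over `Λ`. -/
lemma gint_mul_of_congr (β κ : ℝ) (Λ : Finset (Site d)) {f g : Config d → ℝ≥0∞}
    (hf : Measurable f)
    (hg : ∀ S S' : Config d, (∀ x ∉ Λ, S x = S' x) → g S = g S') (η : Config d) :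
    gint β κ Λ (fun S => g S * f S) η = g η * gint β κ Λ f η := by
  unfold gint lmarginal
  rw [← lintegral_const_mul]
  · refine lintegral_congr fun s => ?_
    dsimp only
    rw [hg (Function.updateFinset η Λ s) η fun x hx => by simp [Function.updateFinset, hx],
      mul_assoc]
  · exact (hf.mul (measurable_boltz β κ Λ)).comp measurable_updateFinset

/-- Consistency of the finite-volume Gibbs kernels. -/
lemma lintegral_finiteGibbs_comp {β κ : ℝ} (hβ : 0 ≤ β) (hκ : 0 < κ) {Δ Λ : Finset (Site d)}
    (h : Δ ⊆ Λ) {f : Config d → ℝ≥0∞} (hf : Measurable f) (η : Config d) :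
    ∫⁻ S, (∫⁻ S', f S' ∂finiteGibbs β κ Δ S) ∂finiteGibbs β κ Λ η
      = ∫⁻ S, f S ∂finiteGibbs β κ Λ η := by
  have hm := measurable_lintegral_finiteGibbs β κ Δ hf
  rw [lintegral_finiteGibbs β κ Λ η hf, lintegral_finiteGibbs β κ Λ η hm]
  congr 1
  have key : ∀ S, gint β κ Δ (fun S => ∫⁻ S', f S' ∂finiteGibbs β κ Δ S) S = gint β κ Δ f S := by
    intro S
    have := gint_mul_of_congr β κ Δ (f := 1) (g := fun S => ∫⁻ S', f S' ∂finiteGibbs β κ Δ S)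
      measurable_one (fun S S' hS => lintegral_finiteGibbs_congr β κ Δ hf hS) S
    simp only [Pi.one_apply, mul_one] at this
    rw [this, lintegral_finiteGibbs β κ Δ S hf, mul_right_comm,
      ENNReal.inv_mul_cancel (gint_one_ne_zero β κ Δ S) (gint_one_ne_top hβ hκ Δ S), one_mul]
  exact le_antisymm (gint_mono_of_subset β κ h hm hf (fun S => (key S).le) η)
    (gint_mono_of_subset β κ h hf hm (fun S => (key S).ge) η)

/-- The measure `μ` is preserved by the Gibbs kernel of the volume `Λ`. -/
def KernelInvariant (β κ : ℝ) (Λ : Finset (Site d)) (μ : Measure (Config d)) : Prop :=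
  ∀ f : Config d → ℝ≥0∞, Measurable f →
    ∫⁻ η, (∫⁻ S, f S ∂finiteGibbs β κ Λ η) ∂μ = ∫⁻ S, f S ∂μ

/-- Membership in a cylinder event on `Δ` is decided by the spins in `Δ`. -/
lemma measurableSet_congr_of_cylinderEvents {Δ : Set (Site d)} {C : Set (Config d)}
    (hC : MeasurableSet[cylinderEvents Δ] C) {S S' : Config d} (h : ∀ x ∈ Δ, S x = S' x) :
    S ∈ C ↔ S' ∈ C := by
  classical
  let r : Config d → Config d := fun T x => if x ∈ Δ then T x else (0, 1)
  have hr : r S = r S' := by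
    ext x : 1
    by_cases hx : x ∈ Δ
    · simp [r, hx, h x hx]
    · simp [r, hx]
  have hle : cylinderEvents Δ ≤ MeasurableSpace.comap r ⊤ := by
    refine iSup₂_le fun x hx => ?_
    rintro _ ⟨t, -, rfl⟩
    refine ⟨(fun T => T x) ⁻¹' t, trivial, ?_⟩
    ext T
    simp [r, hx]
  obtain ⟨D, -, rfl⟩ := hle _ hC
  simp [hr]

/-- A probability measure preserved by all finite-volume Gibbs kernels satisfies the DLR
condition, because these kernels leave the spins outside their volume unchanged. -/
lemma isGibbs_of_kernelInvariant {β κ : ℝ} (hβ : 0 ≤ β) (hκ : 0 < κ) (μ : Measure (Config d))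
    [IsProbabilityMeasure μ] (h : ∀ Λ : Finset (Site d), KernelInvariant β κ Λ μ) :
    IsGibbs β κ μ := by
  classical
  refine ⟨inferInstance, fun Λ A hA => ?_⟩
  have hle : cylinderEvents ((Λ : Set (Site d))ᶜ)
      ≤ MeasurableSpace.pi (X := fun _ : Site d => Spin) := cylinderEvents_le_pi
  have hprob := isProbabilityMeasure_finiteGibbs (d := d) hβ hκ Λ
  have hA1 : Measurable (A.indicator (1 : Config d → ℝ≥0∞)) := measurable_one.indicator hA
  have hval : ∀ η, finiteGibbs β κ Λ η A
      = ∫⁻ S, A.indicator (1 : Config d → ℝ≥0∞) S ∂finiteGibbs β κ Λ η := fun η => by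
    rw [lintegral_indicator_one hA]
  have hmeas0 : Measurable fun η => finiteGibbs β κ Λ η A := by
    simp only [hval]
    exact measurable_lintegral_finiteGibbs β κ Λ hA1
  -- resetting the spins in `Λ` shows that the kernel depends measurably on the outside spins only
  let r : Config d → Config d := fun η x => if x ∈ Λ then (0, 1) else η x
  have hr : Measurable[cylinderEvents ((Λ : Set (Site d))ᶜ)] r := by
    refine @measurable_pi_lambda _ _ _ (cylinderEvents ((Λ : Set (Site d))ᶜ)) _ _ fun x => ?_
    by_cases hx : x ∈ Λ
    · simp only [r, hx, if_true]
      exact measurable_const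
    · simp only [r, hx, if_false]
      exact measurable_cylinderEvent_apply (by simpa using hx)
  have hmeas : Measurable[cylinderEvents ((Λ : Set (Site d))ᶜ)]
      fun η => finiteGibbs β κ Λ η A := by
    have : (fun η => finiteGibbs β κ Λ η A) = (fun η => finiteGibbs β κ Λ η A) ∘ r := by
      ext η
      simp only [Function.comp, hval]
      exact lintegral_finiteGibbs_congr β κ Λ hA1 fun x hx => by simp [r, hx]
    rw [this]
    exact hmeas0.comp hr
  have hint : Integrable (fun η => (finiteGibbs β κ Λ η).real A) μ := by
    refine Integrable.of_bound (C := 1) hmeas0.ennreal_toReal.aestronglyMeasurable ?_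
    refine Filter.Eventually.of_forall fun η => ?_
    rw [Real.norm_of_nonneg measureReal_nonneg]
    exact measureReal_le_one
  refine (ae_eq_condExp_of_forall_setIntegral_eq hle
    ((integrable_const (1 : ℝ)).indicator hA) (fun C _ _ => hint.integrableOn) ?_ ?_).symm
  · intro C hC _
    have hC' : MeasurableSet C := hle C hC
    rw [integral_indicator hA, Measure.restrict_restrict hA, setIntegral_const, smul_eq_mul,
      mul_one]
    simp only [measureReal_def]
    rw [integral_toReal hmeas0.aemeasurable (Filter.Eventually.of_forall fun η =>
      measure_lt_top _ _)]
    congr 1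
    have h1 := h Λ ((A ∩ C).indicator 1) (measurable_one.indicator (hA.inter hC'))
    rw [lintegral_indicator_one (hA.inter hC')] at h1
    rw [← h1, ← lintegral_indicator hC']
    refine lintegral_congr fun η => ?_
    rw [lintegral_indicator_one (hA.inter hC')]
    have hglue : ∀ s, (glue Λ s η ∈ C ↔ η ∈ C) := fun s =>
      measurableSet_congr_of_cylinderEvents hC fun x hx => by
        have : x ∉ Λ := by simpa using hx
        simp [glue, this]
    simp only [finiteGibbs, Measure.smul_apply, Set.indicator]
    rw [Measure.map_apply (measurable_glue Λ η) hA,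
      Measure.map_apply (measurable_glue Λ η) (hA.inter hC')]
    by_cases hη : η ∈ C
    · simp [hη, Set.preimage, hglue]
    · simp [hη, Set.preimage, hglue]
  · exact hmeas.ennreal_toReal.stronglyMeasurable.aestronglyMeasurable

/-! ### Linearity of Gibbs integrals -/

lemma gint_mono (β κ : ℝ) (Λ : Finset (Site d)) {f g : Config d → ℝ≥0∞} (h : ∀ S, f S ≤ g S)
    (η : Config d) : gint β κ Λ f η ≤ gint β κ Λ g η :=
  lmarginal_mono (fun S => mul_le_mul_left (h S) _) η

lemma gint_add (β κ : ℝ) (Λ : Finset (Site d)) {f : Config d → ℝ≥0∞} (g : Config d → ℝ≥0∞)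
    (hf : Measurable f) (η : Config d) :
    gint β κ Λ (fun S => f S + g S) η = gint β κ Λ f η + gint β κ Λ g η := by
  have hm : Measurable fun s : Λ → Spin => f (Function.updateFinset η Λ s)
      * boltz β κ Λ (Function.updateFinset η Λ s) :=
    (hf.mul (measurable_boltz β κ Λ)).comp measurable_updateFinset
  unfold gint lmarginal
  rw [← lintegral_add_left hm]
  exact lintegral_congr fun s => by simp [add_mul]

lemma gint_const_mul (β κ : ℝ) (Λ : Finset (Site d)) (c : ℝ≥0∞) {f : Config d → ℝ≥0∞}
    (hf : Measurable f) (η : Config d) :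
    gint β κ Λ (fun S => c * f S) η = c * gint β κ Λ f η :=
  gint_mul_of_congr β κ Λ (g := fun _ => c) hf (fun _ _ _ => rfl) η

lemma gint_finset_sum (β κ : ℝ) (Λ : Finset (Site d)) {ι : Type*} (s : Finset ι)
    {f : ι → Config d → ℝ≥0∞} (hf : ∀ i, Measurable (f i)) (η : Config d) :
    gint β κ Λ (fun S => ∑ i ∈ s, f i S) η = ∑ i ∈ s, gint β κ Λ (f i) η := by
  unfold gint lmarginal
  rw [← lintegral_finsetSum]
  · exact lintegral_congr fun s => by simp [Finset.sum_mul]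
  · exact fun i _ => ((hf i).mul (measurable_boltz β κ Λ)).comp measurable_updateFinset

/-! ### Second moments of the field around the Ising spins -/

/-- The deviation `φ_x - σ_x`. -/
def dev (S : Config d) (x : Site d) : ℝ := phi S x - ((sigma S x : ℤ) : ℝ)

@[fun_prop]
lemma measurable_dev (x : Site d) : Measurable fun S : Config d => dev S x := by
  unfold dev
  fun_prop

/-- The second moment about `s` of a Gaussian with mean `m` and variance `1 / a`, in terms of its
unnormalised density. -/
lemma lintegral_sq_mul_gaussian {a : ℝ} (ha : 0 < a) (m s : ℝ) :
    ∫⁻ t : ℝ, ENNReal.ofReal ((t - s) ^ 2) * ENNReal.ofReal (Real.exp (-(a / 2 * (t - m) ^ 2)))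
      = ENNReal.ofReal (1 / a + (m - s) ^ 2)
        * ∫⁻ t : ℝ, ENNReal.ofReal (Real.exp (-(a / 2 * (t - m) ^ 2))) := by
  obtain ⟨v, hv⟩ : ∃ v : NNReal, (v : ℝ) = 1 / a := ⟨⟨1 / a, by positivity⟩, rfl⟩
  have hv0 : v ≠ 0 := by
    rintro rfl
    have : 0 < 1 / a := by positivity
    rw [← hv] at this
    simp at this
  set c : ℝ := (√(2 * Real.pi * v))⁻¹ with hc
  have hvpos : (0 : ℝ) < v := by positivity
  have hcpos : 0 < c := by positivity
  have hpdf : ∀ t, gaussianPDF m v t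
      = ENNReal.ofReal c * ENNReal.ofReal (Real.exp (-(a / 2 * (t - m) ^ 2))) := by
    intro t
    rw [gaussianPDF, gaussianPDFReal_def, ← ENNReal.ofReal_mul hcpos.le]
    simp only [hc]
    congr 3
    rw [hv]
    field_simp
  have hmeas : Measurable fun t : ℝ => ENNReal.ofReal (Real.exp (-(a / 2 * (t - m) ^ 2))) := by
    fun_prop
  have h1 : ENNReal.ofReal c
      * ∫⁻ t : ℝ, ENNReal.ofReal (Real.exp (-(a / 2 * (t - m) ^ 2))) = 1 := by
    rw [← lintegral_const_mul _ hmeas, ← lintegral_gaussianPDF_eq_one m hv0]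
    exact lintegral_congr fun t => (hpdf t).symm
  have hL2 : MemLp (fun t : ℝ => t) 2 (gaussianReal m v) :=
    memLp_id_gaussianReal (μ := m) (v := v) 2
  have hint1 : Integrable (fun t : ℝ => t - m) (gaussianReal m v) :=
    (hL2.integrable (by norm_num)).sub (integrable_const _)
  have hint2 : Integrable (fun t : ℝ => (t - m) ^ 2) (gaussianReal m v) :=
    (hL2.sub (memLp_const m)).integrable_sq
  have hint3 : Integrable (fun t : ℝ => 2 * (m - s) * (t - m) + (m - s) ^ 2) (gaussianReal m v) :=
    (hint1.const_mul _).add (integrable_const _)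
  have hexp : ∀ t : ℝ, (t - s) ^ 2 = (t - m) ^ 2 + (2 * (m - s) * (t - m) + (m - s) ^ 2) :=
    fun t => by ring
  have hmean : ∫ t, (t - m) ∂gaussianReal m v = 0 := by
    rw [integral_sub (hL2.integrable (by norm_num)) (integrable_const _), integral_id_gaussianReal]
    simp
  have hvar : ∫ t, (t - m) ^ 2 ∂gaussianReal m v = v := by
    have := variance_fun_id_gaussianReal (μ := m) (v := v)
    rwa [variance_eq_integral (by fun_prop), integral_id_gaussianReal] at this
  have hint : Integrable (fun t : ℝ => (t - s) ^ 2) (gaussianReal m v) :=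
    (hL2.sub (memLp_const s)).integrable_sq
  have h2 : ENNReal.ofReal c * ∫⁻ t : ℝ, ENNReal.ofReal ((t - s) ^ 2)
      * ENNReal.ofReal (Real.exp (-(a / 2 * (t - m) ^ 2)))
      = ENNReal.ofReal (1 / a + (m - s) ^ 2) := by
    have e : ∫ t, (t - s) ^ 2 ∂gaussianReal m v = 1 / a + (m - s) ^ 2 := by
      rw [integral_congr_ae (Filter.Eventually.of_forall hexp), integral_add hint2 hint3,
        integral_add (hint1.const_mul _) (integrable_const _), integral_const_mul, hmean, hvar, hv]
      simp
    rw [← e, ofReal_integral_eq_lintegral_ofReal hint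
      (Filter.Eventually.of_forall fun t => sq_nonneg _), gaussianReal_of_var_ne_zero m hv0,
      lintegral_withDensity_eq_lintegral_mul _ (measurable_gaussianPDF m v) (by fun_prop),
      ← lintegral_const_mul _ (by fun_prop)]
    refine lintegral_congr fun t => ?_
    rw [Pi.mul_apply, hpdf]
    ring
  have hc0 : ENNReal.ofReal c ≠ 0 := by simpa using hcpos
  rw [← ENNReal.mul_right_inj hc0 ENNReal.ofReal_ne_top, h2, mul_left_comm, h1, mul_one]

lemma unitVec_ne_zero (i : Fin d) : (unitVec i : Site d) ≠ 0 := by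
  intro h
  have := congrFun h i
  simp [unitVec] at this

lemma energy_singleton (β κ : ℝ) (x : Site d) (S : Config d) :
    energy β κ {x} S
      = β * (∑ i : Fin d, ((phi S x - phi S (x + unitVec i)) ^ 2
          + (phi S x - phi S (x - unitVec i)) ^ 2))
        + κ / 2 * phi S x ^ 2 - κ * (phi S x * ((sigma S x : ℤ) : ℝ)) := by
  unfold energy
  simp only [Finset.sum_singleton]
  congr 3
  refine Finset.sum_congr rfl fun i _ => ?_
  have hne : x ∉ ({x - unitVec i} : Finset (Site d)) := by
    rw [Finset.mem_singleton]
    exact fun h => unitVec_ne_zero i (sub_eq_self.1 h.symm)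
  have : bondBases {x} i = insert x {x - unitVec i} := by
    ext z
    simp [bondBases]
  rw [this, Finset.sum_insert hne, Finset.sum_singleton, sub_add_cancel]
  ring

lemma phi_update_self (S : Config d) (x : Site d) (s : Spin) :
    phi (Function.update S x s) x = s.1 := by simp [phi]

lemma sigma_update_self (S : Config d) (x : Site d) (s : Spin) :
    sigma (Function.update S x s) x = s.2 := by simp [sigma]

lemma phi_update_of_ne (S : Config d) {x y : Site d} (s : Spin) (h : y ≠ x) :
    phi (Function.update S x s) y = phi S y := by simp [phi, h]

lemma dev_update_of_ne (S : Config d) {x y : Site d} (s : Spin) (h : y ≠ x) :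
    dev (Function.update S x s) y = dev S y := by simp [dev, phi, sigma, h]

/-- The small parameter of the model: it bounds the squared influence of the neighbours on the
conditional mean of the field. -/
def couplingRatio (d : ℕ) (β κ : ℝ) : ℝ := (2 * β / κ) ^ 2 * (2 * d)

/-- An upper bound for the conditional second moment of `φ_x - σ_x`, in terms of the
neighbours of `x`. -/
def neighbourBound (β κ : ℝ) (x : Site d) (S : Config d) : ℝ :=
  1 / κ + couplingRatio d β κ *
    ∑ i : Fin d, (2 * dev S (x + unitVec i) ^ 2 + 2 * dev S (x - unitVec i) ^ 2 + 16)

/-- A function of the configuration that only depends on its Ising spins. -/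
def SpinFunction (g : Config d → ℝ≥0∞) : Prop :=
  ∀ S S' : Config d, (∀ x, sigma S x = sigma S' x) → g S = g S'

lemma unit_sub_sq_le (u v : ℤˣ) : ((u : ℤ) - (v : ℤ) : ℝ) ^ 2 ≤ 4 := by
  rcases Int.units_eq_one_or u with rfl | rfl <;> rcases Int.units_eq_one_or v with rfl | rfl <;>
    norm_num

lemma sq_phi_sub_le (S : Config d) (y : Site d) (u : ℤˣ) :
    (phi S y - ((u : ℤ) : ℝ)) ^ 2 ≤ 2 * dev S y ^ 2 + 8 := by
  have h := unit_sub_sq_le (sigma S y) u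
  unfold dev
  nlinarith [sq_nonneg
    ((phi S y - ((sigma S y : ℤ) : ℝ)) - (((sigma S y : ℤ) : ℝ) - ((u : ℤ) : ℝ)))]

/-- Given all other spins, `φ_x` is Gaussian with variance `1 / (κ + 4 d β)` and a mean that is a
convex combination of `σ_x` and the field at the neighbours. -/
lemma gint_singleton_dev_sq_le {β κ : ℝ} (hβ : 0 ≤ β) (hκ : 0 < κ) (x : Site d)
    {g : Config d → ℝ≥0∞} (hg : Measurable g) (hgs : SpinFunction g) (η : Config d) :
    gint β κ {x} (fun S => g S * ENNReal.ofReal (dev S x ^ 2)) η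
      ≤ gint β κ {x} (fun S => g S * ENNReal.ofReal (neighbourBound β κ x S)) η := by
  have hnb : Measurable (neighbourBound (d := d) β κ x) := by
    unfold neighbourBound
    fun_prop
  have hm1 : Measurable fun S : Config d =>
      g S * ENNReal.ofReal (dev S x ^ 2) * boltz β κ {x} S := by fun_prop
  have hm2 : Measurable fun S : Config d =>
      g S * ENNReal.ofReal (neighbourBound β κ x S) * boltz β κ {x} S := by fun_prop
  unfold gint
  rw [lmarginal_singleton, lmarginal_singleton]
  refine (lintegral_aPriori (hm1.comp (measurable_update η))).trans_le
    (le_trans ?_ (lintegral_aPriori (hm2.comp (measurable_update η))).ge)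
  dsimp only [Function.comp]
  refine Finset.sum_le_sum fun u _ => ?_
  have hp : ∀ i : Fin d, x + unitVec i ≠ x := fun i => by simp [unitVec_ne_zero]
  have hn : ∀ i : Fin d, x - unitVec i ≠ x := fun i => by simp [unitVec_ne_zero]
  set a : ℝ := κ + 4 * d * β with ha
  have hapos : 0 < a := by positivity
  set T : ℝ := ∑ i : Fin d, (phi η (x + unitVec i) + phi η (x - unitVec i)) with hT
  set Q : ℝ := ∑ i : Fin d, (phi η (x + unitVec i) ^ 2 + phi η (x - unitVec i) ^ 2) with hQ
  -- completing the square: the conditional mean of `φ_x` is `m` and its variance is `1 / a`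
  set m : ℝ := (κ * ((u : ℤ) : ℝ) + 2 * β * T) / a with hm
  have hen : ∀ t : ℝ, energy β κ {x} (Function.update η x (t, u))
      = a / 2 * (t - m) ^ 2 + (β * Q - a / 2 * m ^ 2) := by
    intro t
    rw [energy_singleton]
    simp only [phi_update_self, sigma_update_self, phi_update_of_ne _ _ (hp _),
      phi_update_of_ne _ _ (hn _)]
    have e : ∑ i : Fin d, ((t - phi η (x + unitVec i)) ^ 2 + (t - phi η (x - unitVec i)) ^ 2)
        = 2 * d * t ^ 2 - 2 * t * T + Q := by
      rw [hT, hQ, Finset.mul_sum]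
      have : (2 * d * t ^ 2 : ℝ) = ∑ _i : Fin d, 2 * t ^ 2 := by
        simp; ring
      rw [this, ← Finset.sum_sub_distrib, ← Finset.sum_add_distrib]
      exact Finset.sum_congr rfl fun i _ => by ring
    have e2 : a * m = κ * ((u : ℤ) : ℝ) + 2 * β * T := by
      rw [hm]; field_simp
    rw [e]
    have e3 : a / 2 * (t - m) ^ 2 = a / 2 * t ^ 2 - (a * m) * t + a / 2 * m ^ 2 := by ring
    rw [e3, e2, ha]
    ring
  have hboltz : ∀ t : ℝ, boltz β κ {x} (Function.update η x (t, u))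
      = ENNReal.ofReal (Real.exp (-(β * Q - a / 2 * m ^ 2)))
        * ENNReal.ofReal (Real.exp (-(a / 2 * (t - m) ^ 2))) := by
    intro t
    rw [boltz, hen, neg_add, add_comm, Real.exp_add, ENNReal.ofReal_mul (Real.exp_pos _).le]
  have hgc : ∀ t : ℝ, g (Function.update η x (t, u)) = g (Function.update η x (0, u)) := by
    intro t
    refine hgs _ _ fun y => ?_
    by_cases hy : y = x
    · subst hy; simp [sigma]
    · simp [sigma, hy]
  have hnbc : ∀ t : ℝ, neighbourBound β κ x (Function.update η x (t, u))
      = neighbourBound β κ x η := by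
    intro t
    simp only [neighbourBound, dev_update_of_ne _ _ (hp _), dev_update_of_ne _ _ (hn _)]
  have hdev : ∀ t : ℝ, dev (Function.update η x (t, u)) x = t - ((u : ℤ) : ℝ) := by
    intro t
    simp [dev, phi, sigma]
  -- the conditional second moment is at most `neighbourBound`
  have hreal : 1 / a + (m - ((u : ℤ) : ℝ)) ^ 2 ≤ neighbourBound β κ x η := by
    have hsum : m - ((u : ℤ) : ℝ) = 2 * β / a *
        ∑ i : Fin d, ((phi η (x + unitVec i) - ((u : ℤ) : ℝ))
          + (phi η (x - unitVec i) - ((u : ℤ) : ℝ))) := by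
      have : ∑ i : Fin d, ((phi η (x + unitVec i) - ((u : ℤ) : ℝ))
          + (phi η (x - unitVec i) - ((u : ℤ) : ℝ))) = T - 2 * d * ((u : ℤ) : ℝ) := by
        have h2 : (2 * d * ((u : ℤ) : ℝ) : ℝ) = ∑ _i : Fin d, 2 * ((u : ℤ) : ℝ) := by
          simp; ring
        rw [hT, h2, ← Finset.sum_sub_distrib]
        exact Finset.sum_congr rfl fun i _ => by ring
      rw [this, hm]
      field_simp
      rw [ha]
      ring
    have hcs : (∑ i : Fin d, ((phi η (x + unitVec i) - ((u : ℤ) : ℝ))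
          + (phi η (x - unitVec i) - ((u : ℤ) : ℝ)))) ^ 2
        ≤ (2 * d) * ∑ i : Fin d, (2 * dev η (x + unitVec i) ^ 2
          + 2 * dev η (x - unitVec i) ^ 2 + 16) := by
      refine sq_sum_le_card_mul_sum_sq.trans ?_
      rw [Finset.card_univ, Fintype.card_fin, mul_comm 2 (d : ℝ), mul_assoc,
        Finset.mul_sum _ _ (2 : ℝ)]
      refine mul_le_mul_of_nonneg_left (Finset.sum_le_sum fun i _ => ?_) (by positivity)
      have h1 := sq_phi_sub_le η (x + unitVec i) u
      have h2 := sq_phi_sub_le η (x - unitVec i) u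
      nlinarith [sq_nonneg ((phi η (x + unitVec i) - ((u : ℤ) : ℝ))
          - (phi η (x - unitVec i) - ((u : ℤ) : ℝ)))]
    have hle : κ ≤ a := by
      rw [ha]
      have : 0 ≤ 4 * (d : ℝ) * β := by positivity
      linarith
    rw [neighbourBound, hsum, mul_pow, couplingRatio, mul_assoc]
    gcongr
  calc ∫⁻ t : ℝ, g (Function.update η x (t, u))
        * ENNReal.ofReal (dev (Function.update η x (t, u)) x ^ 2)
        * boltz β κ {x} (Function.update η x (t, u))
      = ∫⁻ t : ℝ, (g (Function.update η x (0, u))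
          * ENNReal.ofReal (Real.exp (-(β * Q - a / 2 * m ^ 2))))
          * (ENNReal.ofReal ((t - ((u : ℤ) : ℝ)) ^ 2)
            * ENNReal.ofReal (Real.exp (-(a / 2 * (t - m) ^ 2)))) := by
        refine lintegral_congr fun t => ?_
        rw [hboltz, hgc, hdev]
        ring
    _ = (g (Function.update η x (0, u))
          * ENNReal.ofReal (Real.exp (-(β * Q - a / 2 * m ^ 2))))
        * (ENNReal.ofReal (1 / a + (m - ((u : ℤ) : ℝ)) ^ 2)
          * ∫⁻ t : ℝ, ENNReal.ofReal (Real.exp (-(a / 2 * (t - m) ^ 2)))) := by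
        rw [lintegral_const_mul _ (by fun_prop), lintegral_sq_mul_gaussian hapos]
    _ ≤ (g (Function.update η x (0, u))
          * ENNReal.ofReal (Real.exp (-(β * Q - a / 2 * m ^ 2))))
        * (ENNReal.ofReal (neighbourBound β κ x η)
          * ∫⁻ t : ℝ, ENNReal.ofReal (Real.exp (-(a / 2 * (t - m) ^ 2)))) := by
        gcongr
    _ = ∫⁻ t : ℝ, g (Function.update η x (t, u))
        * ENNReal.ofReal (neighbourBound β κ x (Function.update η x (t, u)))
        * boltz β κ {x} (Function.update η x (t, u)) := by
        rw [← mul_assoc, ← lintegral_const_mul _ (by fun_prop)]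
        refine lintegral_congr fun t => ?_
        rw [hboltz, hgc t, hnbc]
        ring

/-- The all-plus boundary condition. -/
def plusConfig (d : ℕ) : Config d := fun _ => (1, 1)

lemma gint_eq_zero_of_glue (β κ : ℝ) (Λ : Finset (Site d)) {f : Config d → ℝ≥0∞} (η : Config d)
    (h : ∀ s : Λ → Spin, f (glue Λ s η) = 0) : gint β κ Λ f η = 0 := by
  unfold gint lmarginal
  refine (lintegral_congr fun s => ?_).trans lintegral_zero
  dsimp only
  rw [← glue_eq_updateFinset, h, zero_mul]

/-- The bound on the second moments of `φ_x - σ_x` under plus boundary conditions, relative to the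
probability of an event that depends on the Ising spins alone. -/
lemma gint_dev_sq_le {β κ : ℝ} (hβ : 0 ≤ β) (hκ : 0 < κ)
    (hratio : 4 * d * couplingRatio d β κ ≤ 1 / 2) (Λ : Finset (Site d))
    {g : Config d → ℝ≥0∞} (hg : Measurable g) (hgs : SpinFunction g) (hg1 : ∀ S, g S ≤ 1)
    (x : Site d) :
    gint β κ Λ (fun S => g S * ENNReal.ofReal (dev S x ^ 2)) (plusConfig d)
      ≤ ENNReal.ofReal (2 / κ + 32 * d * couplingRatio d β κ) * gint β κ Λ g (plusConfig d) := by
  set D := couplingRatio d β κ with hD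
  have hD0 : 0 ≤ D := by rw [hD, couplingRatio]; positivity
  set u : Site d → ℝ≥0∞ := fun y =>
    gint β κ Λ (fun S => g S * ENNReal.ofReal (dev S y ^ 2)) (plusConfig d) with hu
  set P := gint β κ Λ g (plusConfig d) with hP
  have hmeas : ∀ y, Measurable fun S : Config d => g S * ENNReal.ofReal (dev S y ^ 2) := by
    intro y; fun_prop
  have hout : ∀ y ∉ Λ, u y = 0 := by
    intro y hy
    refine gint_eq_zero_of_glue _ _ _ _ fun s => ?_
    have : dev (glue Λ s (plusConfig d)) y = 0 := by
      simp [dev, phi, sigma, glue, hy, plusConfig]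
    simp [this]
  have hfin : ∀ y ∈ Λ, u y < ∞ := by
    intro y hy
    refine gint_lt_top hβ hκ Λ _ fun S => ?_
    refine (mul_le_mul_left (hg1 S) _).trans ?_
    rw [one_mul]
    refine ENNReal.ofReal_le_ofReal ?_
    have h1 : 1 + dev S y ^ 2 ≤ ∏ x ∈ Λ, (1 + (phi S x - ((sigma S x : ℤ) : ℝ)) ^ 2) := by
      rw [← Finset.mul_prod_erase _ _ hy]
      exact le_mul_of_one_le_right (by positivity) (one_le_prod_one_add_sq (Λ.erase y) S)
    linarith
  have hrec : ∀ y ∈ Λ, u y ≤ ENNReal.ofReal (1 / κ + 16 * d * D) * P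
      + ENNReal.ofReal (2 * D) * ∑ i : Fin d, (u (y + unitVec i) + u (y - unitVec i)) := by
    intro y hy
    have hnb : Measurable (neighbourBound (d := d) β κ y) := by
      unfold neighbourBound
      fun_prop
    refine (gint_mono_of_subset β κ (Finset.singleton_subset_iff.2 hy) (hmeas y) (by fun_prop)
      (gint_singleton_dev_sq_le hβ hκ y hg hgs) _).trans (le_of_eq ?_)
    have hpt : ∀ S : Config d, g S * ENNReal.ofReal (neighbourBound β κ y S)
        = ENNReal.ofReal (1 / κ + 16 * d * D) * g S
          + ENNReal.ofReal (2 * D) * ∑ i : Fin d, (g S * ENNReal.ofReal (dev S (y + unitVec i) ^ 2)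
            + g S * ENNReal.ofReal (dev S (y - unitVec i) ^ 2)) := by
      intro S
      have : neighbourBound β κ y S = (1 / κ + 16 * d * D)
          + 2 * D * ∑ i : Fin d, (dev S (y + unitVec i) ^ 2 + dev S (y - unitVec i) ^ 2) := by
        rw [neighbourBound, ← hD]
        simp only [Finset.sum_add_distrib, ← Finset.mul_sum]
        simp
        ring
      rw [this, ENNReal.ofReal_add (by positivity) (by positivity),
        ENNReal.ofReal_mul (by positivity), ENNReal.ofReal_sum_of_nonneg (fun _ _ => by positivity)]
      simp only [ENNReal.ofReal_add (sq_nonneg _) (sq_nonneg _), ← mul_add, ← Finset.mul_sum]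
      ring
    simp only [hpt]
    rw [gint_add _ _ _ _ (by fun_prop), gint_const_mul _ _ _ _ hg,
      gint_const_mul _ _ _ _ (by fun_prop), gint_finset_sum _ _ _ _ (fun i => by fun_prop)]
    congr 2
    refine Finset.sum_congr rfl fun i _ => ?_
    rw [gint_add _ _ _ _ (hmeas _)]
  rcases Λ.eq_empty_or_nonempty with hΛ | hΛ
  · have : u x = 0 := hout x (by simp [hΛ])
    change u x ≤ _
    simp [this]
  obtain ⟨z, hz, hmax⟩ := Finset.exists_max_image Λ u hΛ
  have hmax' : ∀ y, u y ≤ u z := fun y => by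
    by_cases hy : y ∈ Λ
    · exact hmax y hy
    · simp [hout y hy]
  -- at a site of maximal second moment the neighbours contribute at most half of it
  have hhalf : u z ≤ ENNReal.ofReal (1 / κ + 16 * d * D) * P + 2⁻¹ * u z := by
    refine (hrec z hz).trans (add_le_add le_rfl ?_)
    calc ENNReal.ofReal (2 * D) * ∑ i : Fin d, (u (z + unitVec i) + u (z - unitVec i))
        ≤ ENNReal.ofReal (2 * D) * ∑ _i : Fin d, (u z + u z) := by
          gcongr <;> exact hmax' _
      _ = ENNReal.ofReal (4 * d * D) * u z := by
          rw [Finset.sum_const, Finset.card_univ, Fintype.card_fin, nsmul_eq_mul, ← two_mul,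
            show 4 * d * D = 2 * D * (d * 2) by ring, ENNReal.ofReal_mul (by positivity),
            ENNReal.ofReal_mul (by positivity)]
          simp
          ring
      _ ≤ 2⁻¹ * u z := by
          gcongr
          rw [show (2⁻¹ : ℝ≥0∞) = ENNReal.ofReal (1 / 2) by
            rw [one_div, ENNReal.ofReal_inv_of_pos two_pos]; simp]
          exact ENNReal.ofReal_le_ofReal hratio
  have hz' : u z ≠ ∞ := (hfin z hz).ne
  have h2 : 2⁻¹ * u z ≤ ENNReal.ofReal (1 / κ + 16 * d * D) * P := by
    have e : u z = 2⁻¹ * u z + 2⁻¹ * u z := by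
      rw [← add_mul, ENNReal.inv_two_add_inv_two, one_mul]
    rw [e] at hhalf
    conv_rhs at hhalf => rw [← e]
    refine ENNReal.le_of_add_le_add_right (a := 2⁻¹ * u z) ?_ hhalf
    exact ENNReal.mul_ne_top (by simp) hz'
  refine (hmax' x).trans ?_
  calc u z = 2 * (2⁻¹ * u z) := by
        rw [← mul_assoc, ENNReal.mul_inv_cancel two_ne_zero ENNReal.ofNat_ne_top, one_mul]
    _ ≤ 2 * (ENNReal.ofReal (1 / κ + 16 * d * D) * P) := by gcongr
    _ = ENNReal.ofReal (2 / κ + 32 * d * D) * P := by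
        rw [← mul_assoc, show 2 / κ + 32 * d * D = 2 * (1 / κ + 16 * d * D) by ring,
          ENNReal.ofReal_mul two_pos.le]
        simp

/-! ### Flipping the spins inside a contour -/

/-- The reflection `(φ, σ) ↦ (-φ, -σ)` of one spin. -/
def flipSpin (s : Spin) : Spin := (-s.1, -s.2)

@[fun_prop]
lemma measurable_flipSpin : Measurable flipSpin :=
  measurable_fst.neg.prodMk
    ((Measurable.of_discrete (f := fun u : ℤˣ => -u)).comp measurable_snd)

lemma measurePreserving_flipSpin : MeasurePreserving flipSpin aPriori aPriori := by
  refine ⟨measurable_flipSpin, ?_⟩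
  refine Measure.ext_of_lintegral _ fun f hf => ?_
  rw [lintegral_map hf measurable_flipSpin, lintegral_aPriori hf]
  refine (lintegral_aPriori (hf.comp measurable_flipSpin)).trans ?_
  refine Eq.trans ?_ (Equiv.sum_comp (Equiv.neg ℤˣ) fun u => ∫⁻ t : ℝ, f (t, u))
  refine Finset.sum_congr rfl fun u _ => ?_
  have hm : Measurable fun t : ℝ => f (t, -u) := hf.comp (by fun_prop)
  exact (Measure.measurePreserving_neg (volume : Measure ℝ)).lintegral_comp hm

/-- The reflection of all spins in `B`. -/
def flipOn (B : Set (Site d)) (S : Config d) : Config d :=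
  open Classical in fun x => if x ∈ B then flipSpin (S x) else S x

lemma measurable_flipOn (B : Set (Site d)) : Measurable (flipOn B) := by
  refine measurable_pi_lambda _ fun x => ?_
  by_cases hx : x ∈ B
  · simp only [flipOn, hx, if_true]
    fun_prop
  · simp only [flipOn, hx, if_false]
    fun_prop

lemma phi_flipOn (B : Set (Site d)) (S : Config d) (x : Site d) [Decidable (x ∈ B)] :
    phi (flipOn B S) x = if x ∈ B then -phi S x else phi S x := by
  by_cases hx : x ∈ B <;> simp [phi, flipOn, hx, flipSpin]

lemma sigma_flipOn (B : Set (Site d)) (S : Config d) (x : Site d) [Decidable (x ∈ B)] :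
    sigma (flipOn B S) x = if x ∈ B then -sigma S x else sigma S x := by
  by_cases hx : x ∈ B <;> simp [sigma, flipOn, hx, flipSpin]

/-- Reflecting the spins in a set changes the integral over `Λ` only through the boundary
condition. -/
lemma lmarginal_comp_flipOn (B : Set (Site d)) (Λ : Finset (Site d)) {F : Config d → ℝ≥0∞}
    (hF : Measurable F) (η : Config d) :
    lmarginal (fun _ => aPriori) Λ (fun S => F (flipOn B S)) η
      = lmarginal (fun _ => aPriori) Λ F (flipOn B η) := by
  classical
  have hmp : MeasurePreserving (fun (s : Λ → Spin) (x : Λ) =>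
      (if (x : Site d) ∈ B then flipSpin else id) (s x))
      (Measure.pi fun _ : Λ => aPriori) (Measure.pi fun _ : Λ => aPriori) := by
    refine measurePreserving_pi _ _ fun x => ?_
    split_ifs
    · exact measurePreserving_flipSpin
    · exact MeasurePreserving.id _
  unfold lmarginal
  have hm : Measurable fun s : Λ → Spin => F (Function.updateFinset (flipOn B η) Λ s) :=
    hF.comp measurable_updateFinset
  rw [← hmp.lintegral_comp hm]
  refine lintegral_congr fun s => congrArg F ?_
  ext x : 1
  by_cases hx : x ∈ Λ <;> by_cases hxB : x ∈ B <;> simp [flipOn, Function.updateFinset, hx, hxB]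

/-- A nearest-neighbour bond: the pair `⟨i, x⟩` stands for the bond `{x, x + unitVec i}`. -/
abbrev Bond (d : ℕ) : Type := Σ _ : Fin d, Site d

/-- The other endpoint of a bond. -/
def Bond.tip (e : Bond d) : Site d := e.2 + unitVec e.1

/-- The bonds with at least one endpoint in `Λ`. -/
def bonds (Λ : Finset (Site d)) : Finset (Bond d) := Finset.univ.sigma fun i => bondBases Λ i

lemma mem_bonds {Λ : Finset (Site d)} {e : Bond d} : e ∈ bonds Λ ↔ e.2 ∈ Λ ∨ e.tip ∈ Λ := by
  simp only [bonds, bondBases, Finset.mem_sigma, Finset.mem_univ, true_and, Finset.mem_union,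
    Finset.mem_image, Bond.tip]
  refine or_congr Iff.rfl ⟨?_, fun h => ⟨_, h, by simp⟩⟩
  rintro ⟨y, hy, h⟩
  rw [← h]
  simpa using hy

/-- The edge boundary of a finite set of sites. -/
def bdry (B : Finset (Site d)) : Finset (Bond d) :=
  (bonds B).filter fun e => ¬(e.2 ∈ B ↔ e.tip ∈ B)

lemma mem_bdry {B : Finset (Site d)} {e : Bond d} : e ∈ bdry B ↔ ¬(e.2 ∈ B ↔ e.tip ∈ B) := by
  rw [bdry, Finset.mem_filter, mem_bonds]
  tauto

lemma bdry_eq_filter {B Λ : Finset (Site d)} (h : B ⊆ Λ) :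
    bdry B = (bonds Λ).filter fun e => ¬(e.2 ∈ B ↔ e.tip ∈ B) := by
  ext e
  rw [mem_bdry, Finset.mem_filter, mem_bonds]
  have h1 := @h e.2
  have h2 := @h e.tip
  tauto

lemma energy_eq_sum_bonds (β κ : ℝ) (Λ : Finset (Site d)) (S : Config d) :
    energy β κ Λ S = β * (∑ e ∈ bonds Λ, (phi S e.2 - phi S e.tip) ^ 2)
      + κ / 2 * (∑ x ∈ Λ, phi S x ^ 2) - κ * (∑ x ∈ Λ, phi S x * ((sigma S x : ℤ) : ℝ)) := by
  rw [energy, bonds, Finset.sum_sigma]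
  rfl

/-- Reflecting the spins in `B` changes the energy by boundary terms only. -/
lemma energy_flipOn (β κ : ℝ) {B Λ : Finset (Site d)} (h : B ⊆ Λ) (S : Config d) :
    energy β κ Λ (flipOn B S)
      = energy β κ Λ S + 4 * β * ∑ e ∈ bdry B, phi S e.2 * phi S e.tip := by
  classical
  have e1 : ∑ e ∈ bonds Λ, (phi (flipOn B S) e.2 - phi (flipOn B S) e.tip) ^ 2
      = ∑ e ∈ bonds Λ, (phi S e.2 - phi S e.tip) ^ 2
        + 4 * ∑ e ∈ bdry B, phi S e.2 * phi S e.tip := by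
    rw [bdry_eq_filter h, Finset.sum_filter, Finset.mul_sum, ← Finset.sum_add_distrib]
    refine Finset.sum_congr rfl fun e _ => ?_
    simp only [phi_flipOn, Finset.mem_coe]
    by_cases h1 : e.2 ∈ B <;> by_cases h2 : e.tip ∈ B <;> simp [h1, h2] <;> ring
  have e2 : ∑ x ∈ Λ, phi (flipOn B S) x ^ 2 = ∑ x ∈ Λ, phi S x ^ 2 := by
    refine Finset.sum_congr rfl fun x _ => ?_
    rw [phi_flipOn]
    split_ifs <;> ring
  have e3 : ∑ x ∈ Λ, phi (flipOn B S) x * ((sigma (flipOn B S) x : ℤ) : ℝ)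
      = ∑ x ∈ Λ, phi S x * ((sigma S x : ℤ) : ℝ) := by
    refine Finset.sum_congr rfl fun x _ => ?_
    rw [phi_flipOn, sigma_flipOn]
    split_ifs <;> simp
  rw [energy_eq_sum_bonds, energy_eq_sum_bonds, e1, e2, e3]
  ring

/-- The energy in `Λ` is invariant under the reflection of all spins. -/
lemma energy_flipOn_univ (β κ : ℝ) (Λ : Finset (Site d)) (S : Config d) :
    energy β κ Λ (flipOn Set.univ S) = energy β κ Λ S := by
  classical
  rw [energy_eq_sum_bonds, energy_eq_sum_bonds]
  simp only [phi_flipOn, sigma_flipOn, Set.mem_univ, if_true, Units.val_neg, Int.cast_neg,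
    neg_mul_neg, neg_sq]
  congr 3
  exact Finset.sum_congr rfl fun e _ => by ring

/-- The event that the Ising spins disagree along every bond of `γ`. -/
def contourEvent (γ : Finset (Bond d)) : Set (Config d) :=
  {S | ∀ e ∈ γ, sigma S e.2 = -sigma S e.tip}

lemma measurableSet_contourEvent (γ : Finset (Bond d)) : MeasurableSet (contourEvent γ) := by
  have : contourEvent γ = ⋂ e ∈ γ, {S : Config d | sigma S e.2 = -sigma S e.tip} := by
    ext S; simp [contourEvent]
  rw [this]
  refine Finset.measurableSet_biInter _ fun e _ => ?_
  exact measurableSet_eq_fun (measurable_sigma _)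
    ((Measurable.of_discrete (f := fun u : ℤˣ => -u)).comp (measurable_sigma _))

lemma spinFunction_indicator_contourEvent (γ : Finset (Bond d)) :
    SpinFunction ((contourEvent γ).indicator (1 : Config d → ℝ≥0∞)) := by
  intro S S' h
  have : S ∈ contourEvent γ ↔ S' ∈ contourEvent γ := by
    simp only [contourEvent, Set.mem_ofPred_eq, h]
  by_cases hS : S ∈ contourEvent γ
  · simp [hS, this.1 hS]
  · have hS' : S' ∉ contourEvent γ := fun h' => hS (this.2 h')
    simp [hS, hS']

/-- Along a contour the products `φ_x φ_y` are close to `-1`, up to the deviations from the Ising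
spins. -/
lemma sum_bdry_le {B : Finset (Site d)} {S : Config d} (hS : S ∈ contourEvent (bdry B)) :
    ∑ e ∈ bdry B, phi S e.2 * phi S e.tip
      ≤ -(3 / 4) * (bdry B).card
        + 5 / 2 * ∑ e ∈ bdry B, (dev S e.2 ^ 2 + dev S e.tip ^ 2) := by
  have : (-(3 / 4) * (bdry B).card : ℝ) = ∑ _e ∈ bdry B, (-(3 / 4) : ℝ) := by
    simp; ring
  rw [this, Finset.mul_sum, ← Finset.sum_add_distrib]
  refine Finset.sum_le_sum fun e he => ?_
  have h1 : phi S e.2 = dev S e.2 + ((sigma S e.2 : ℤ) : ℝ) := by simp [dev]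
  have h2 : phi S e.tip = dev S e.tip + ((sigma S e.tip : ℤ) : ℝ) := by simp [dev]
  rw [h1, h2, hS e he]
  rcases Int.units_eq_one_or (sigma S e.tip) with h | h <;> rw [h] <;> push_cast <;>
    nlinarith [sq_nonneg (dev S e.2 - dev S e.tip), sq_nonneg (dev S e.2 - 1 / 4),
      sq_nonneg (dev S e.2 + 1 / 4), sq_nonneg (dev S e.tip - 1 / 4),
      sq_nonneg (dev S e.tip + 1 / 4)]

/-- The constant bounding the second moments of `φ_x - σ_x`. -/
def devBound (d : ℕ) (β κ : ℝ) : ℝ := 2 / κ + 32 * d * couplingRatio d β κ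

/-- The Peierls estimate: the probability that the Ising spins disagree along the boundary of `B`
is exponentially small in the length of that boundary. -/
lemma gint_contourEvent_le {β κ : ℝ} (hβ : 0 < β) (hκ : 0 < κ)
    (hratio : 4 * d * couplingRatio d β κ ≤ 1 / 2) (hdev : 20 * devBound d β κ ≤ 1 / 2)
    {B Λ : Finset (Site d)} (hB : B ⊆ Λ) :
    gint β κ Λ ((contourEvent (bdry B)).indicator 1) (plusConfig d)
      ≤ ENNReal.ofReal (2 * Real.exp (-(2 * β * (bdry B).card))) * gint β κ Λ 1 (plusConfig d) := by
  set n := (bdry B).card with hn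
  set g : Config d → ℝ≥0∞ := (contourEvent (bdry B)).indicator 1 with hg
  have hgm : Measurable g := measurable_one.indicator (measurableSet_contourEvent (bdry B))
  have hg1 : ∀ S, g S ≤ 1 := fun S => Set.indicator_le_self' (by simp) S
  set P := gint β κ Λ g (plusConfig d) with hP
  set Z := gint β κ Λ 1 (plusConfig d) with hZ
  have hPZ : P ≤ Z := gint_mono β κ Λ hg1 _
  have hδ0 : 0 ≤ devBound d β κ := by
    unfold devBound couplingRatio
    positivity
  rcases Nat.eq_zero_or_pos n with hn0 | hnpos
  · refine hPZ.trans ?_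
    rw [hn0]
    simp only [Nat.cast_zero, mul_zero, neg_zero, Real.exp_zero, mul_one]
    exact le_mul_of_one_le_left' (by norm_num)
  have hnR : (0 : ℝ) < n := by exact_mod_cast hnpos
  set E := Real.exp (2 * β * n) with hE
  have hEpos : 0 < E := Real.exp_pos _
  -- the reflected configuration has a much larger Boltzmann factor, unless deviations are large
  have hpt : ∀ S, ENNReal.ofReal E * g S * boltz β κ Λ S
      ≤ boltz β κ Λ (flipOn B S) + ENNReal.ofReal (E * (10 / n)) * (∑ e ∈ bdry B,
        (g S * ENNReal.ofReal (dev S e.2 ^ 2) + g S * ENNReal.ofReal (dev S e.tip ^ 2)))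
          * boltz β κ Λ S := by
    intro S
    by_cases hS : S ∈ contourEvent (bdry B)
    swap
    · simp [hg, hS]
    have hgS : g S = 1 := by simp [hg, hS]
    simp only [hgS, one_mul, mul_one]
    set Q := ∑ e ∈ bdry B, (dev S e.2 ^ 2 + dev S e.tip ^ 2) with hQ
    have hQ0 : 0 ≤ Q := Finset.sum_nonneg fun _ _ => by positivity
    have hQ' : ∑ e ∈ bdry B, (ENNReal.ofReal (dev S e.2 ^ 2) + ENNReal.ofReal (dev S e.tip ^ 2))
        = ENNReal.ofReal Q := by
      rw [hQ, ENNReal.ofReal_sum_of_nonneg (fun _ _ => by positivity)]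
      exact Finset.sum_congr rfl fun e _ =>
        (ENNReal.ofReal_add (sq_nonneg _) (sq_nonneg _)).symm
    have hflip : boltz β κ Λ (flipOn B S) ≥
        ENNReal.ofReal (Real.exp (3 * β * n - 10 * β * Q)) * boltz β κ Λ S := by
      unfold boltz
      rw [← ENNReal.ofReal_mul (Real.exp_pos _).le, ← Real.exp_add, energy_flipOn β κ hB]
      refine ENNReal.ofReal_le_ofReal (Real.exp_le_exp.2 ?_)
      have := mul_le_mul_of_nonneg_left (sum_bdry_le hS) (show 0 ≤ 4 * β by positivity)
      rw [← hQ, ← hn] at this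
      linarith
    have hexp : E ≤ Real.exp (3 * β * n - 10 * β * Q) + E * (10 / n) * Q := by
      rcases le_total (n : ℝ) (10 * Q) with h | h
      · have : 1 ≤ 10 / n * Q := by
          rw [div_mul_eq_mul_div, one_le_div hnR]
          exact h
        nlinarith [Real.exp_pos (3 * β * n - 10 * β * Q)]
      · have : E ≤ Real.exp (3 * β * n - 10 * β * Q) := by
          refine Real.exp_le_exp.2 ?_
          nlinarith
        have h3 : 0 ≤ E * (10 / n) * Q := by positivity
        linarith
    rw [hQ', ← ENNReal.ofReal_mul (by positivity)]
    calc ENNReal.ofReal E * boltz β κ Λ S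
        ≤ ENNReal.ofReal (Real.exp (3 * β * n - 10 * β * Q) + E * (10 / n) * Q)
          * boltz β κ Λ S := by gcongr
      _ = ENNReal.ofReal (Real.exp (3 * β * n - 10 * β * Q)) * boltz β κ Λ S
          + ENNReal.ofReal (E * (10 / n) * Q) * boltz β κ Λ S := by
          rw [ENNReal.ofReal_add (Real.exp_pos _).le (by positivity), add_mul]
      _ ≤ _ := by gcongr
  have hmd : ∀ y, Measurable fun S : Config d => g S * ENNReal.ofReal (dev S y ^ 2) := by
    intro y; fun_prop
  have hflipint : lmarginal (fun _ => aPriori) Λ (fun S => boltz β κ Λ (flipOn B S)) (plusConfig d)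
      = Z := by
    rw [lmarginal_comp_flipOn (B : Set (Site d)) Λ (measurable_boltz β κ Λ), hZ, gint]
    simp only [Pi.one_apply, one_mul]
    refine lmarginal_congr _ _ fun x hx => ?_
    have : x ∉ (B : Set (Site d)) := fun h => hx (hB h)
    simp [flipOn, this]
  have hmain : ENNReal.ofReal E * P ≤ Z + ENNReal.ofReal (E * (10 / n)) *
      ∑ e ∈ bdry B,
        (ENNReal.ofReal (devBound d β κ) * P + ENNReal.ofReal (devBound d β κ) * P) := by
    calc ENNReal.ofReal E * P
        = lmarginal (fun _ => aPriori) Λ (fun S => ENNReal.ofReal E * g S * boltz β κ Λ S)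
            (plusConfig d) := (gint_const_mul β κ Λ _ hgm _).symm
      _ ≤ lmarginal (fun _ => aPriori) Λ (fun S => boltz β κ Λ (flipOn B S)
            + ENNReal.ofReal (E * (10 / n)) * (∑ e ∈ bdry B,
              (g S * ENNReal.ofReal (dev S e.2 ^ 2) + g S * ENNReal.ofReal (dev S e.tip ^ 2)))
                * boltz β κ Λ S) (plusConfig d) := lmarginal_mono hpt _
      _ = Z + gint β κ Λ (fun S => ENNReal.ofReal (E * (10 / n)) * (∑ e ∈ bdry B,
              (g S * ENNReal.ofReal (dev S e.2 ^ 2) + g S * ENNReal.ofReal (dev S e.tip ^ 2))))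
                (plusConfig d) := by
          rw [← hflipint]
          exact lintegral_add_left (((measurable_boltz β κ Λ).comp
            (measurable_flipOn _)).comp measurable_updateFinset) _
      _ = Z + ENNReal.ofReal (E * (10 / n)) * ∑ e ∈ bdry B,
            (gint β κ Λ (fun S => g S * ENNReal.ofReal (dev S e.2 ^ 2)) (plusConfig d)
              + gint β κ Λ (fun S => g S * ENNReal.ofReal (dev S e.tip ^ 2)) (plusConfig d)) := by
          rw [gint_const_mul _ _ _ _ (by fun_prop), gint_finset_sum _ _ _ _ (fun i => by fun_prop)]
          congr 2
          exact Finset.sum_congr rfl fun e _ => gint_add _ _ _ _ (hmd _) _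
      _ ≤ _ := by
          have := gint_dev_sq_le hβ.le hκ hratio Λ hgm
            (spinFunction_indicator_contourEvent (bdry B)) hg1
          gcongr
          · exact this _
          · exact this _
  have hPfin : P ≠ ∞ := (hPZ.trans_lt (gint_one_ne_top hβ.le hκ Λ _).lt_top).ne
  have hhalf : ENNReal.ofReal E * P ≤ Z + 2⁻¹ * (ENNReal.ofReal E * P) := by
    refine hmain.trans (add_le_add le_rfl ?_)
    rw [Finset.sum_const, ← hn, nsmul_eq_mul, ← add_mul, ← mul_assoc, ← mul_assoc, ← mul_assoc]
    refine mul_le_mul_left ?_ _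
    rw [← ENNReal.ofReal_add hδ0 hδ0, ← ENNReal.ofReal_natCast n,
      ← ENNReal.ofReal_mul (by positivity), ← ENNReal.ofReal_mul (by positivity),
      show (2⁻¹ : ℝ≥0∞) = ENNReal.ofReal (1 / 2) by
            rw [one_div, ENNReal.ofReal_inv_of_pos two_pos]; simp,
      ← ENNReal.ofReal_mul (by norm_num)]
    refine ENNReal.ofReal_le_ofReal ?_
    rw [show E * (10 / n) * n * (devBound d β κ + devBound d β κ)
      = E * (20 * devBound d β κ) by field_simp; ring]
    nlinarith
  have h2 : 2⁻¹ * (ENNReal.ofReal E * P) ≤ Z := by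
    have hne : ENNReal.ofReal E * P ≠ ∞ := ENNReal.mul_ne_top ENNReal.ofReal_ne_top hPfin
    generalize ENNReal.ofReal E * P = q at hhalf hne
    have e : q = 2⁻¹ * q + 2⁻¹ * q := by
      rw [← add_mul, ENNReal.inv_two_add_inv_two, one_mul]
    rw [e] at hhalf
    conv_rhs at hhalf => rw [← e]
    exact ENNReal.le_of_add_le_add_right (a := 2⁻¹ * q)
      (ENNReal.mul_ne_top (by simp) hne) hhalf
  calc P = ENNReal.ofReal (2 * Real.exp (-(2 * β * n))) * (2⁻¹ * (ENNReal.ofReal E * P)) := by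
        rw [show (2⁻¹ : ℝ≥0∞) = ENNReal.ofReal (1 / 2) by
            rw [one_div, ENNReal.ofReal_inv_of_pos two_pos]; simp, ← mul_assoc, ← mul_assoc,
          ← ENNReal.ofReal_mul (by positivity), ← ENNReal.ofReal_mul (by positivity)]
        have : 2 * Real.exp (-(2 * β * n)) * (1 / 2) * E = 1 := by
          rw [hE, Real.exp_neg]
          field_simp
        rw [this]
        simp
    _ ≤ _ := by gcongr

/-! ### Closed lattice cochains are exact -/

lemma exists_int_primitive {A : Type*} [AddCommGroup A] (h : ℤ → A) :
    ∃ g : ℤ → A, ∀ t, g (t + 1) - g t = h t := by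
  refine ⟨fun t => match t with
    | Int.ofNat n => ∑ i ∈ Finset.range n, h i
    | Int.negSucc n => -∑ i ∈ Finset.range (n + 1), h (-((i : ℤ) + 1)), fun t => ?_⟩
  rcases t with n | n
  · change (∑ i ∈ Finset.range (n + 1), h i) - ∑ i ∈ Finset.range n, h i = h n
    rw [Finset.sum_range_succ]
    abel
  · rcases n with _ | n
    · change (∑ i ∈ Finset.range 0, h i) - -∑ i ∈ Finset.range 1, h (-((i : ℤ) + 1)) = h (-1)
      simp
    · change (-∑ i ∈ Finset.range (n + 1), h (-((i : ℤ) + 1)))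
        - -∑ i ∈ Finset.range (n + 1 + 1), h (-((i : ℤ) + 1)) = h (-((n + 1 : ℕ) + 1))
      rw [Finset.sum_range_succ _ (n + 1)]
      abel

/-- A one-cochain on the lattice whose sum around every plaquette vanishes is the differential of
a function. The primitive is built one coordinate direction at a time. -/
lemma exists_lattice_primitive {A : Type*} [AddCommGroup A] (a : Fin d → Site d → A)
    (ha : ∀ i j x, a i x + a j (x + unitVec i) = a j x + a i (x + unitVec j)) :
    ∃ f : Site d → A, ∀ i x, f (x + unitVec i) - f x = a i x := by
  choose prim hprim using fun h : ℤ → A => exists_int_primitive h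
  suffices H : ∀ k ≤ d, ∃ f : Site d → A, ∀ i : Fin d, (i : ℕ) < k →
      ∀ x, f (x + unitVec i) - f x = a i x by
    obtain ⟨f, hf⟩ := H d le_rfl
    exact ⟨f, fun i => hf i i.2⟩
  intro k
  induction k with
  | zero => exact fun _ => ⟨0, fun i hi => absurd hi (by simp)⟩
  | succ k ih =>
    intro hk
    obtain ⟨f, hf⟩ := ih (by omega)
    let i₀ : Fin d := ⟨k, by omega⟩
    let b : Fin d → Site d → A := fun i x => a i x - (f (x + unitVec i) - f x)
    have hb : ∀ i j x, b i x + b j (x + unitVec i) = b j x + b i (x + unitVec j) := by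
      intro i j x
      simp only [b]
      have h1 := ha i j x
      rw [add_right_comm x (unitVec j) (unitVec i)]
      rw [← sub_eq_zero] at h1 ⊢
      rw [← h1]
      abel
    have hb0 : ∀ i : Fin d, (i : ℕ) < k → ∀ x, b i x = 0 := fun i hi x => by
      simp only [b, hf i hi, sub_self]
    let g : Site d → A := fun x => prim (fun t => b i₀ (Function.update x i₀ t)) (x i₀)
    refine ⟨fun x => f x + g x, fun i hi x => ?_⟩
    rcases Nat.lt_succ_iff_lt_or_eq.1 hi with hi' | hi'
    · have hne : i ≠ i₀ := fun h => by simp [h, i₀] at hi'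
      have hg : g (x + unitVec i) = g x := by
        have h1 : (x + unitVec i) i₀ = x i₀ := by simp [unitVec, hne.symm]
        simp only [g, h1]
        congr 1
        ext t
        have h2 : Function.update (x + unitVec i) i₀ t = Function.update x i₀ t + unitVec i := by
          ext j
          by_cases hj : j = i₀
          · subst hj; simp [unitVec, hne.symm]
          · simp [hj]
        rw [h2]
        have := hb i i₀ (Function.update x i₀ t)
        rw [hb0 i hi', hb0 i hi', zero_add, add_zero] at this
        exact this
      dsimp only
      rw [hg, ← hf i hi' x]
      abel
    · have hi₀ : i = i₀ := Fin.ext hi'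
      rw [hi₀]
      have hg : g (x + unitVec i₀) - g x = b i₀ x := by
        have h1 : (x + unitVec i₀) i₀ = x i₀ + 1 := by simp [unitVec]
        have h2 : ∀ t, Function.update (x + unitVec i₀) i₀ t = Function.update x i₀ t := by
          intro t
          ext j
          by_cases hj : j = i₀
          · rw [hj]; simp
          · simp [hj, unitVec]
        simp only [g, h1, h2]
        rw [hprim, Function.update_eq_self]
      simp only [b] at hg
      have : f (x + unitVec i₀) + g (x + unitVec i₀) - (f x + g x)
          = (f (x + unitVec i₀) - f x) + (g (x + unitVec i₀) - g x) := by abel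
      dsimp only
      rw [this, hg]
      abel

/-! ### Contours -/

/-- The box `[-n, n]^d`. -/
def box (d n : ℕ) : Finset (Site d) := Finset.Icc (fun _ => -(n : ℤ)) (fun _ => (n : ℤ))

lemma notMem_box {n : ℕ} {x : Site d} : x ∉ box d n ↔ ∃ i, (n : ℤ) < |x i| := by
  simp only [box, Finset.mem_Icc, Pi.le_def, ← forall_and, not_forall, ← abs_le, not_le]

/-- A function on the lattice that does not change in direction `i` along a line is constant on
it. -/
lemma eq_update_of_line {A : Type*} {f : Site d → A} {x : Site d} {i : Fin d}
    (h : ∀ t, f (Function.update x i t + unitVec i) = f (Function.update x i t)) (s : ℤ) :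
    f x = f (Function.update x i s) := by
  have hstep : ∀ t, f (Function.update x i (t + 1)) = f (Function.update x i t) := by
    intro t
    rw [← h t]
    congr 1
    ext j
    by_cases hj : j = i
    · subst hj; simp [unitVec]
    · simp [hj, unitVec]
  have hall : ∀ t, f (Function.update x i t) = f (Function.update x i 0) := by
    intro t
    induction t using Int.induction_on with
    | zero => rfl
    | succ k ih => rw [hstep, ih]
    | pred k ih => rw [← ih, ← hstep, sub_add_cancel]
  rw [hall s, ← hall (x i), Function.update_eq_self]

/-- In dimension at least two the complement of a box is connected. -/
lemma eq_of_notMem_box (hd : 2 ≤ d) {A : Type*} {n : ℕ} {f : Site d → A}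
    (h : ∀ i x, x ∉ box d n → x + unitVec i ∉ box d n → f (x + unitVec i) = f x)
    {y z : Site d} (hy : y ∉ box d n) (hz : z ∉ box d n) : f y = f z := by
  -- outside the box, coordinates other than a large one may be changed freely
  have hmove : ∀ (x : Site d) (i j : Fin d), i ≠ j → (n : ℤ) < |x i| → ∀ s,
      f x = f (Function.update x j s) := by
    intro x i j hij hx s
    refine eq_update_of_line (fun t => h j _ ?_ ?_) s
    · exact notMem_box.2 ⟨i, by simpa [hij] using hx⟩
    · exact notMem_box.2 ⟨i, by simpa [hij, unitVec] using hx⟩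
  have hmany : ∀ (x w : Site d) (i : Fin d), (n : ℤ) < |x i| → w i = x i → f x = f w := by
    intro x w i hx hw
    suffices H : ∀ s : Finset (Fin d), i ∉ s → f x = f (fun j => if j ∈ s then w j else x j) by
      have := H (Finset.univ.erase i) (by simp)
      rw [this]
      congr 1
      ext j
      by_cases hj : j = i
      · subst hj; simp [hw]
      · simp [hj]
    intro s
    induction s using Finset.induction_on with
    | empty => simp
    | insert a s ha ih =>
      intro hi
      rw [Finset.mem_insert, not_or] at hi
      rw [ih hi.2, hmove _ i a hi.1 (by simpa [hi.2] using hx) (w a)]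
      congr 1
      ext j
      by_cases hj : j = a
      · subst hj; simp
      · simp [hj]
  obtain ⟨i, hi⟩ := notMem_box.1 hy
  obtain ⟨j, hj⟩ := notMem_box.1 hz
  by_cases hij : i = j
  · subst hij
    have : Nontrivial (Fin d) := Fin.nontrivial_iff_two_le.2 hd
    obtain ⟨k, hk⟩ := exists_ne i
    have hbig : (n : ℤ) < |(n : ℤ) + 1| := by
      rw [abs_of_pos] <;> omega
    rw [hmove y i k hk.symm hi (n + 1), hmove z i k hk.symm hj (n + 1)]
    exact hmany _ _ k (by simpa using hbig) (by simp)
  · rw [hmany y (Function.update y j (z j)) i hi (by simp [hij])]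
    exact (hmany z _ j hj (by simp)).symm

/-- The bonds whose base differs from that of `e` by at most one in every coordinate. Two bonds of
a common plaquette are near each other. -/
def near (e : Bond d) : Finset (Bond d) := Finset.univ.sigma fun _ => Finset.Icc (e.2 - 1) (e.2 + 1)

lemma mem_near {e e' : Bond d} : e' ∈ near e ↔ ∀ k, |e'.2 k - e.2 k| ≤ 1 := by
  simp only [near, Finset.mem_sigma, Finset.mem_univ, true_and, Finset.mem_Icc, Pi.le_def,
    ← forall_and, Pi.sub_apply, Pi.add_apply, Pi.one_apply]
  refine forall_congr' fun k => ?_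
  rw [abs_le]
  constructor <;> rintro ⟨h1, h2⟩ <;> constructor <;> linarith

lemma near_symm {e e' : Bond d} (h : e' ∈ near e) : e ∈ near e' := by
  rw [mem_near] at h ⊢
  exact fun k => by rw [abs_sub_comm]; exact h k

lemma card_near (e : Bond d) : (near e).card = d * 3 ^ d := by
  rw [near, Finset.card_sigma]
  simp only [Pi.card_Icc, Int.card_Icc, Pi.sub_apply, Pi.add_apply, Pi.one_apply]
  have : ∀ k, (e.2 k + 1 + 1 - (e.2 k - 1)).toNat = 3 := fun k => by
    have : e.2 k + 1 + 1 - (e.2 k - 1) = 3 := by ring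
    rw [this]; rfl
  simp [this]

lemma bdry_symmDiff (B B' : Finset (Site d)) :
    bdry (symmDiff B B') = symmDiff (bdry B) (bdry B') := by
  ext e
  simp only [mem_bdry, Finset.mem_symmDiff]
  tauto

/-- If a part `γ` of the boundary of a subset of a box contains with each bond all nearby bonds of
that boundary, then `γ` is itself the boundary of a subset of the box: it meets every plaquette in
an even number of bonds, so that it is the differential of a `ZMod 2`-valued function. -/
lemma exists_bdry_eq (hd : 2 ≤ d) {n : ℕ} {M : Finset (Site d)} (hM : M ⊆ box d n)
    {γ : Finset (Bond d)} (hγ : γ ⊆ bdry M)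
    (hclosed : ∀ e ∈ γ, ∀ e' ∈ bdry M, e' ∈ near e → e' ∈ γ) :
    ∃ B ⊆ box d n, bdry B = γ := by
  classical
  let a : Fin d → Site d → ZMod 2 := fun i x => if (⟨i, x⟩ : Bond d) ∈ γ then 1 else 0
  let m : Site d → ZMod 2 := fun x => if x ∈ M then 1 else 0
  have hm : ∀ i x, (if (⟨i, x⟩ : Bond d) ∈ bdry M then (1 : ZMod 2) else 0)
      = m x + m (x + unitVec i) := by
    intro i x
    simp only [mem_bdry, Bond.tip, m]
    by_cases h1 : x ∈ M <;> by_cases h2 : x + unitVec i ∈ M <;> simp [h1, h2]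
    decide
  have ha : ∀ i j x, a i x + a j (x + unitVec i) = a j x + a i (x + unitVec j) := by
    intro i j x
    have hone : ∀ i' : Fin d, ∀ k, |(unitVec i' : Site d) k| ≤ 1 := by
      intro i' k
      by_cases hk : k = i'
      · subst hk; simp [unitVec]
      · simp [unitVec, hk]
    have hdiff : ∀ k, |(unitVec i : Site d) k - (unitVec j : Site d) k| ≤ 1 := by
      intro k
      by_cases hi : k = i <;> by_cases hj : k = j <;> simp [unitVec, hi, hj, Pi.single_apply] <;>
        split_ifs <;> simp
    let pl : Finset (Bond d) := {⟨i, x⟩, ⟨j, x + unitVec i⟩, ⟨j, x⟩, ⟨i, x + unitVec j⟩}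
    have hpl : ∀ e ∈ pl, ∀ e' ∈ pl, e' ∈ near e := by
      have hdiff' : ∀ k, |(unitVec j : Site d) k - (unitVec i : Site d) k| ≤ 1 := fun k => by
        rw [abs_sub_comm]; exact hdiff k
      intro e he e' he'
      simp only [pl, Finset.mem_insert, Finset.mem_singleton] at he he'
      rw [mem_near]
      intro k
      rcases he with rfl | rfl | rfl | rfl <;> rcases he' with rfl | rfl | rfl | rfl <;>
        simp [hone, hdiff, hdiff']
    by_cases hex : ∃ e ∈ pl, e ∈ γ
    · obtain ⟨e, he, heγ⟩ := hex
      have hiff : ∀ e' ∈ pl, (e' ∈ γ ↔ e' ∈ bdry M) := fun e' he' =>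
        ⟨fun h => hγ h, fun h => hclosed e heγ e' h (hpl e he e' he')⟩
      simp only [a]
      simp only [hiff ⟨i, x⟩ (by simp [pl]), hiff ⟨j, x + unitVec i⟩ (by simp [pl]),
        hiff ⟨j, x⟩ (by simp [pl]), hiff ⟨i, x + unitVec j⟩ (by simp [pl]), hm]
      rw [add_right_comm x (unitVec j)]
      have h2 : ∀ p q r s : ZMod 2, p + q + (q + r) = p + s + (s + r) := by decide
      exact h2 _ _ _ _
    · push Not at hex
      simp [a, hex ⟨i, x⟩ (by simp [pl]), hex ⟨j, x + unitVec i⟩ (by simp [pl]),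
        hex ⟨j, x⟩ (by simp [pl]), hex ⟨i, x + unitVec j⟩ (by simp [pl])]
  obtain ⟨f, hf⟩ := exists_lattice_primitive a ha
  let y₀ : Site d := fun _ => (n : ℤ) + 1
  have hy₀ : y₀ ∉ box d n := notMem_box.2 ⟨⟨0, by omega⟩, by
    simp only [y₀]; rw [abs_of_pos] <;> omega⟩
  have hconst : ∀ y ∉ box d n, f y = f y₀ := by
    intro y hy
    refine eq_of_notMem_box hd (fun i x hx hx' => ?_) hy hy₀
    have : (⟨i, x⟩ : Bond d) ∉ γ := by
      intro h
      have := mem_bdry.1 (hγ h)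
      have h1 : x ∉ M := fun h => hx (hM h)
      have h2 : x + unitVec i ∉ M := fun h => hx' (hM h)
      simp [Bond.tip, h1, h2] at this
    have h3 := hf i x
    simp only [a, this, if_false] at h3
    exact sub_eq_zero.1 h3
  refine ⟨(box d n).filter fun x => f x ≠ f y₀, Finset.filter_subset _ _, ?_⟩
  have hmem : ∀ x, x ∈ (box d n).filter (fun x => f x ≠ f y₀) ↔ f x ≠ f y₀ := by
    intro x
    rw [Finset.mem_filter, and_iff_right_iff_imp]
    exact fun h => by_contra fun h' => h (hconst x h')
  ext ⟨i, x⟩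
  rw [mem_bdry, hmem, hmem]
  have h3 := hf i x
  simp only [Bond.tip]
  by_cases h : (⟨i, x⟩ : Bond d) ∈ γ
  · simp only [a, h, if_true] at h3
    simp only [h, iff_true]
    have h4 : ∀ p q r : ZMod 2, p - q = 1 → ¬(q ≠ r ↔ p ≠ r) := by decide
    exact h4 _ _ _ h3
  · simp only [a, h, if_false] at h3
    simp [h, sub_eq_zero.1 h3]

/-- A set of bonds is connected if every bond of it can be reached from every other one by steps
between nearby bonds, within the set. This is expressed without paths: a part of the set that is
not empty and contains with each bond all nearby bonds of the set is the whole set. -/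
def BondConnected (γ : Finset (Bond d)) : Prop :=
  ∀ e ∈ γ, ∀ γ' ⊆ γ, e ∈ γ' → (∀ u ∈ γ', ∀ w ∈ γ, w ∈ near u → w ∈ γ') → γ' = γ

/-- Every site of a subset `M` of a box is surrounded by a connected contour that is part of the
boundary of `M`. -/
lemma exists_connected_contour (hd : 2 ≤ d) {n : ℕ} {M : Finset (Site d)} (hM : M ⊆ box d n)
    {x : Site d} (hx : x ∈ M) :
    ∃ B ⊆ box d n, x ∈ B ∧ bdry B ⊆ bdry M ∧ BondConnected (bdry B) := by
  classical
  let F : Finset (Finset (Site d)) :=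
    (box d n).powerset.filter fun B => x ∈ B ∧ bdry B ⊆ bdry M
  have hF : F.Nonempty := ⟨M, by simp [F, hM, hx]⟩
  -- a surrounding set with the shortest boundary has a connected one
  obtain ⟨B, hB, hmin⟩ := Finset.exists_min_image F (fun B => (bdry B).card) hF
  simp only [F, Finset.mem_filter, Finset.mem_powerset] at hB hmin
  refine ⟨B, hB.1, hB.2.1, hB.2.2, fun e he γ hγ heγ hcl => ?_⟩
  by_contra hne
  obtain ⟨B₁, hB₁, hb₁⟩ := exists_bdry_eq hd hB.1 hγ hcl
  have hlt : γ.card < (bdry B).card := Finset.card_lt_card (hγ.ssubset_of_ne hne)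
  by_cases hx₁ : x ∈ B₁
  · have := hmin B₁ ⟨hB₁, hx₁, by rw [hb₁]; exact hγ.trans hB.2.2⟩
    rw [hb₁] at this
    omega
  · have hsd : bdry (symmDiff B B₁) = bdry B \ γ := by
      rw [bdry_symmDiff, hb₁, symmDiff_def]
      ext e
      simp only [Finset.sup_eq_union, Finset.mem_union, Finset.mem_sdiff]
      have := @hγ e
      tauto
    have := hmin (symmDiff B B₁) ⟨?_, ?_, ?_⟩
    · rw [hsd, Finset.card_sdiff_of_subset hγ] at this
      have hpos : 0 < γ.card := Finset.card_pos.2 ⟨e, heγ⟩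
      omega
    · intro y hy
      rcases Finset.mem_symmDiff.1 hy with h | h
      · exact hB.1 h.1
      · exact hB₁ h.1
    · exact Finset.mem_symmDiff.2 (Or.inl ⟨hB.2.1, hx₁⟩)
    · rw [hsd]
      exact Finset.sdiff_subset.trans hB.2.2

/-- The half-line from a point of a finite set in a coordinate direction leaves the set; the bond
along which it does so for the first time belongs to the boundary. -/
lemma exists_exit {B : Finset (Site d)} {x : Site d} (hx : x ∈ B) (i : Fin d) :
    ∃ k : ℕ, (∀ j ≤ k, x + (j : ℤ) • unitVec i ∈ B) ∧
      (⟨i, x + (k : ℤ) • unitVec i⟩ : Bond d) ∈ bdry B := by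
  classical
  have hex : ∃ k : ℕ, x + ((k + 1 : ℕ) : ℤ) • unitVec i ∉ B := by
    by_contra! h
    have hinj : Function.Injective fun k : ℕ => x + ((k + 1 : ℕ) : ℤ) • unitVec i := by
      intro k l hkl
      have := congrFun hkl i
      simpa [unitVec] using this
    exact Set.infinite_of_injective_forall_mem hinj (s := (B : Set (Site d))) h
      B.finite_toSet
  have hin : ∀ j ≤ Nat.find hex, x + (j : ℤ) • unitVec i ∈ B := by
    intro j hj
    rcases j with _ | j
    · simpa using hx
    · by_contra h
      exact Nat.find_min hex (Nat.lt_of_succ_le hj) h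
  refine ⟨Nat.find hex, hin, mem_bdry.2 ?_⟩
  have h1 := hin _ le_rfl
  have h2 := Nat.find_spec hex
  have h3 : Bond.tip ⟨i, x + (Nat.find hex : ℤ) • unitVec i⟩
      = x + ((Nat.find hex + 1 : ℕ) : ℤ) • unitVec i := by
    simp [Bond.tip, add_smul, add_assoc]
  rw [h3]
  tauto

/-- A contour around `x` crosses the half-line from `x` in direction `i` at a distance smaller than
its length: the sites in between lie inside, and each of their lines in another direction is crossed
too. -/
lemma exists_crossing {B : Finset (Site d)} {x : Site d} (hx : x ∈ B) {i j : Fin d} (hij : i ≠ j) :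
    ∃ k < (bdry B).card, (⟨i, x + (k : ℤ) • unitVec i⟩ : Bond d) ∈ bdry B := by
  obtain ⟨k, hk, hmem⟩ := exists_exit hx i
  refine ⟨k, ?_, hmem⟩
  choose t ht using fun l : Fin (k + 1) =>
    exists_exit (hk l (Nat.lt_succ_iff.1 l.2)) j
  let F : Fin (k + 1) → Bond d := fun l =>
    ⟨j, x + ((l : ℕ) : ℤ) • unitVec i + (t l : ℤ) • unitVec j⟩
  have hF : Function.Injective F := by
    intro l l' h
    have h1 : (F l).2 i = (F l').2 i := by rw [h]
    simpa [F, unitVec, hij, Fin.ext_iff] using h1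
  have := Finset.card_le_card_of_injOn F (s := Finset.univ) (t := bdry B)
    (fun l _ => (ht l).2) hF.injOn
  simpa using this

/-! ### Counting connected contours -/

/-- The walks with `m` steps between nearby bonds that start at a given bond. -/
def walks : ℕ → Bond d → Finset (List (Bond d))
  | 0, e => {[e]}
  | m + 1, e => (near e).biUnion fun e' => (walks m e').image (List.cons e)

lemma card_walks_le (m : ℕ) (e : Bond d) : (walks m e).card ≤ (d * 3 ^ d) ^ m := by
  induction m generalizing e with
  | zero => simp [walks]
  | succ m ih =>
    rw [walks]
    refine (Finset.card_biUnion_le_card_mul _ _ ((d * 3 ^ d) ^ m) fun e' _ =>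
      Finset.card_image_le.trans (ih e')).trans ?_
    rw [card_near, pow_succ']

lemma mem_of_mem_walks {m : ℕ} {e : Bond d} {l : List (Bond d)} (hl : l ∈ walks m e) : e ∈ l := by
  cases m with
  | zero => simp_all [walks]
  | succ m =>
    simp only [walks, Finset.mem_biUnion, Finset.mem_image] at hl
    obtain ⟨e', -, l', -, rfl⟩ := hl
    simp

/-- A walk can be made to visit one more bond, next to one it visits already, by a detour of two
steps. -/
lemma exists_detour {m : ℕ} {e : Bond d} {l : List (Bond d)} (hl : l ∈ walks m e) {u w : Bond d}
    (hu : u ∈ l) (hw : w ∈ near u) :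
    ∃ l' ∈ walks (m + 2) e, l'.toFinset = insert w l.toFinset := by
  have hself : ∀ (m : ℕ) (e : Bond d) (l : List (Bond d)), l ∈ walks m e → w ∈ near e →
      ∃ l' ∈ walks (m + 2) e, l'.toFinset = insert w l.toFinset := by
    intro m e l hl hw
    refine ⟨e :: w :: l, ?_, ?_⟩
    · rw [walks, Finset.mem_biUnion]
      refine ⟨w, hw, Finset.mem_image_of_mem _ ?_⟩
      rw [walks, Finset.mem_biUnion]
      exact ⟨e, near_symm hw, Finset.mem_image_of_mem _ hl⟩
    · have := mem_of_mem_walks hl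
      ext v
      simp only [List.toFinset_cons, Finset.mem_insert, List.mem_toFinset]
      grind
  induction m generalizing e l with
  | zero =>
    have hl' := hl
    simp only [walks, Finset.mem_singleton] at hl'
    subst hl'
    rw [List.mem_singleton] at hu
    subst hu
    exact hself 0 _ _ hl hw
  | succ m ih =>
    by_cases hue : u = e
    · subst hue
      exact hself _ _ _ hl hw
    · simp only [walks, Finset.mem_biUnion, Finset.mem_image] at hl
      obtain ⟨e', he', t, ht, rfl⟩ := hl
      obtain ⟨t', ht', hins⟩ := ih ht (by simpa [hue] using hu)
      refine ⟨e :: t', ?_, ?_⟩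
      · rw [walks, Finset.mem_biUnion]
        exact ⟨e', he', Finset.mem_image_of_mem _ ht'⟩
      · rw [List.toFinset_cons, List.toFinset_cons, hins, Finset.insert_comm]

/-- A connected set of `n` bonds is covered by a walk with `2 (n - 1)` steps. -/
lemma exists_walk_of_bondConnected {γ : Finset (Bond d)} (hγ : BondConnected γ) {e : Bond d}
    (he : e ∈ γ) : ∃ l ∈ walks (2 * (γ.card - 1)) e, l.toFinset = γ := by
  suffices H : ∀ k < γ.card, ∃ l ∈ walks (2 * k) e, l.toFinset ⊆ γ ∧ l.toFinset.card = k + 1 by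
    have hpos : 0 < γ.card := Finset.card_pos.2 ⟨e, he⟩
    obtain ⟨l, hl, hsub, hcard⟩ := H (γ.card - 1) (by omega)
    exact ⟨l, hl, Finset.eq_of_subset_of_card_le hsub (by omega)⟩
  intro k
  induction k with
  | zero => exact fun _ => ⟨[e], by simp [walks], by simpa using he, by simp⟩
  | succ k ih =>
    intro hk
    obtain ⟨l, hl, hsub, hcard⟩ := ih (by omega)
    have hex : ∃ u ∈ l.toFinset, ∃ w ∈ γ, w ∈ near u ∧ w ∉ l.toFinset := by
      by_contra! h
      have := hγ e he l.toFinset hsub (by simpa using mem_of_mem_walks hl) h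
      rw [this] at hcard
      omega
    obtain ⟨u, hu, w, hw, hwu, hwl⟩ := hex
    obtain ⟨l', hl', hins⟩ := exists_detour hl (by simpa using hu) hwu
    refine ⟨l', by rw [mul_add]; exact hl', ?_, ?_⟩
    · rw [hins]
      exact Finset.insert_subset hw hsub
    · rw [hins, Finset.card_insert_of_notMem hwl, hcard]

/-! ### Bounds in finite volume -/

lemma gint_mono_glue (β κ : ℝ) (Λ : Finset (Site d)) {f g : Config d → ℝ≥0∞} {η : Config d}
    (h : ∀ s : Λ → Spin, f (glue Λ s η) ≤ g (glue Λ s η)) :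
    gint β κ Λ f η ≤ gint β κ Λ g η := by
  unfold gint lmarginal
  refine lintegral_mono fun s => ?_
  dsimp only
  rw [← glue_eq_updateFinset]
  exact mul_le_mul_left (h s) _

lemma measurableSet_sigma_eq (x : Site d) (u : ℤˣ) : MeasurableSet {S : Config d | sigma S x = u} :=
  measurable_sigma x (measurableSet_singleton u)

/-- The contours of length `n` in `Λ` that cross the half-line from `x` in direction `i` at a
distance smaller than `n` and are covered by walks. -/
def contours (Λ : Finset (Site d)) (x : Site d) (i : Fin d) (n : ℕ) : Finset (Finset (Bond d)) :=
  open Classical in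
  ((Finset.range n).biUnion fun k =>
    (walks (2 * (n - 1)) ⟨i, x + (k : ℤ) • unitVec i⟩).image List.toFinset).filter
      fun γ => γ.card = n ∧ ∃ B ⊆ Λ, bdry B = γ

lemma card_contours_le (Λ : Finset (Site d)) (x : Site d) (i : Fin d) (n : ℕ) :
    (contours Λ x i n).card ≤ n * (d * 3 ^ d) ^ (2 * (n - 1)) := by
  refine (Finset.card_filter_le _ _).trans ((Finset.card_biUnion_le_card_mul _ _ _
    fun k _ => Finset.card_image_le.trans (card_walks_le _ _)).trans ?_)
  rw [Finset.card_range]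

/-- If `σ_x = -1` under plus boundary conditions, then some contour around `x` occurs. -/
lemma exists_contour_of_sigma_eq_neg_one (hd : 2 ≤ d) {n : ℕ} {x : Site d} (i : Fin d)
    {s : box d n → Spin} (hs : sigma (glue (box d n) s (plusConfig d)) x = -1) :
    ∃ m < (bonds (box d n)).card + 1, ∃ γ ∈ contours (box d n) x i m,
      glue (box d n) s (plusConfig d) ∈ contourEvent γ := by
  classical
  set S := glue (box d n) s (plusConfig d) with hS
  have hout : ∀ y ∉ box d n, sigma S y = 1 := fun y hy => by
    simp [hS, sigma, glue, hy, plusConfig]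
  let M : Finset (Site d) := (box d n).filter fun y => sigma S y = -1
  have hM : ∀ y, y ∈ M ↔ sigma S y = -1 := by
    intro y
    rw [Finset.mem_filter, and_iff_right_iff_imp]
    intro h
    by_contra h'
    rw [hout y h'] at h
    exact absurd h (by decide)
  obtain ⟨B, hB, hxB, hBM, hconn⟩ := exists_connected_contour hd
    (Finset.filter_subset _ _ : M ⊆ box d n) ((hM x).2 hs)
  have : Nontrivial (Fin d) := Fin.nontrivial_iff_two_le.2 hd
  obtain ⟨j, hj⟩ := exists_ne i
  obtain ⟨k, hk, hmem⟩ := exists_crossing hxB hj.symm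
  obtain ⟨l, hl, hlγ⟩ := exists_walk_of_bondConnected hconn hmem
  refine ⟨(bdry B).card, ?_, bdry B, ?_, ?_⟩
  · rw [bdry_eq_filter hB]
    exact Nat.lt_succ_of_le (Finset.card_filter_le _ _)
  · rw [contours, Finset.mem_filter]
    refine ⟨?_, rfl, B, hB, rfl⟩
    rw [Finset.mem_biUnion]
    exact ⟨k, Finset.mem_range.2 hk, Finset.mem_image.2 ⟨l, hl, hlγ⟩⟩
  · intro e he
    have h1 := mem_bdry.1 (hBM he)
    rw [hM, hM] at h1
    rcases Int.units_eq_one_or (sigma S e.2) with h2 | h2 <;>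
      rcases Int.units_eq_one_or (sigma S e.tip) with h3 | h3 <;> simp_all

/-- The Peierls argument: under plus boundary conditions minus spins are unlikely, uniformly in the
volume. -/
lemma gint_sigma_eq_neg_one_le (hd : 2 ≤ d) {β κ : ℝ} (hβ : 0 < β) (hκ : 0 < κ)
    (hratio : 4 * d * couplingRatio d β κ ≤ 1 / 2) (hdev : 20 * devBound d β κ ≤ 1 / 2)
    (hcount : 2 * ((d * 3 ^ d : ℕ) : ℝ) ^ 2 * Real.exp (-(2 * β)) ≤ 1 / 2) (n : ℕ) (x : Site d) :
    gint β κ (box d n) ({S | sigma S x = -1}.indicator 1) (plusConfig d)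
      ≤ ENNReal.ofReal (4 * Real.exp (-(2 * β))) * gint β κ (box d n) 1 (plusConfig d) := by
  set Λ := box d n
  set K : ℕ := d * 3 ^ d with hK
  set Z := gint β κ Λ 1 (plusConfig d) with hZ
  set N := (bonds Λ).card
  let i : Fin d := ⟨0, by omega⟩
  have hmeas : ∀ γ : Finset (Bond d),
      Measurable ((contourEvent γ).indicator (1 : Config d → ℝ≥0∞)) :=
    fun γ => measurable_one.indicator (measurableSet_contourEvent γ)
  -- the number of contours of length `m` times the Peierls bound
  let t : ℕ → ℝ := fun m => m * K ^ (2 * (m - 1)) * (2 * Real.exp (-(2 * β * m)))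
  have ht0 : ∀ m, 0 ≤ t m := fun m => by positivity
  have ht : ∀ m, t (m + 1) ≤ 2 * Real.exp (-(2 * β)) * (1 / 2) ^ m := by
    intro m
    have h1 : ((m + 1 : ℕ) : ℝ) ≤ 2 ^ m := by exact_mod_cast Nat.lt_two_pow_self
    have h2 : Real.exp (-(2 * β * (m + 1 : ℕ)))
        = Real.exp (-(2 * β)) * Real.exp (-(2 * β)) ^ m := by
      rw [← Real.exp_nat_mul, ← Real.exp_add]
      push_cast
      ring_nf
    calc t (m + 1) = ((m + 1 : ℕ) : ℝ) * (K ^ (2 * m)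
          * (2 * (Real.exp (-(2 * β)) * Real.exp (-(2 * β)) ^ m))) := by
          simp only [t, h2, Nat.add_sub_cancel]
          ring
      _ ≤ 2 ^ m * (K ^ (2 * m) * (2 * (Real.exp (-(2 * β)) * Real.exp (-(2 * β)) ^ m))) := by
          gcongr
      _ = 2 * Real.exp (-(2 * β)) * (2 * (K : ℝ) ^ 2 * Real.exp (-(2 * β))) ^ m := by
          rw [mul_pow, mul_pow, pow_mul]
          ring
      _ ≤ _ := by gcongr
  have hsum : ∑ m ∈ Finset.range (N + 1), t m ≤ 4 * Real.exp (-(2 * β)) := by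
    rw [Finset.sum_range_succ', show t 0 = 0 by simp [t], add_zero]
    have hgeom : ∑ m ∈ Finset.range N, (1 / 2 : ℝ) ^ m ≤ 2 := by
      have := summable_geometric_two.sum_le_tsum (Finset.range N) (fun _ _ => by positivity)
      rwa [tsum_geometric_two] at this
    calc ∑ m ∈ Finset.range N, t (m + 1)
        ≤ ∑ m ∈ Finset.range N, 2 * Real.exp (-(2 * β)) * (1 / 2) ^ m :=
          Finset.sum_le_sum fun m _ => ht m
      _ = 2 * Real.exp (-(2 * β)) * ∑ m ∈ Finset.range N, (1 / 2 : ℝ) ^ m := by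
          rw [Finset.mul_sum]
      _ ≤ 2 * Real.exp (-(2 * β)) * 2 := by gcongr
      _ = _ := by ring
  calc gint β κ Λ ({S | sigma S x = -1}.indicator 1) (plusConfig d)
      ≤ gint β κ Λ (fun S => ∑ m ∈ Finset.range (N + 1), ∑ γ ∈ contours Λ x i m,
          (contourEvent γ).indicator 1 S) (plusConfig d) := by
        refine gint_mono_glue _ _ _ fun s => ?_
        by_cases hs : sigma (glue Λ s (plusConfig d)) x = -1
        swap
        · simp [hs]
        obtain ⟨m, hm, γ, hγ, hmem⟩ := exists_contour_of_sigma_eq_neg_one hd i hs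
        calc {S : Config d | sigma S x = -1}.indicator 1 (glue Λ s (plusConfig d))
            ≤ (contourEvent γ).indicator (1 : Config d → ℝ≥0∞) (glue Λ s (plusConfig d)) := by
              rw [Set.indicator_of_mem (s := contourEvent γ) hmem]
              exact Set.indicator_le_self' (fun _ _ => zero_le) _
          _ ≤ ∑ γ ∈ contours Λ x i m, (contourEvent γ).indicator (1 : Config d → ℝ≥0∞)
                (glue Λ s (plusConfig d)) :=
              Finset.single_le_sum (f := fun γ => (contourEvent γ).indicator (1 : Config d → ℝ≥0∞)
                (glue Λ s (plusConfig d))) (fun _ _ => zero_le) hγ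
          _ ≤ _ := Finset.single_le_sum (f := fun m => ∑ γ ∈ contours Λ x i m,
                (contourEvent γ).indicator (1 : Config d → ℝ≥0∞) (glue Λ s (plusConfig d)))
                (fun _ _ => zero_le) (Finset.mem_range.2 hm)
    _ = ∑ m ∈ Finset.range (N + 1), ∑ γ ∈ contours Λ x i m,
          gint β κ Λ ((contourEvent γ).indicator 1) (plusConfig d) := by
        rw [gint_finset_sum _ _ _ _ (fun m => Finset.measurable_fun_sum _ fun γ _ => hmeas γ)]
        refine Finset.sum_congr rfl fun m _ => ?_
        exact gint_finset_sum _ _ _ _ hmeas _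
    _ ≤ ∑ m ∈ Finset.range (N + 1), ENNReal.ofReal (t m) * Z := by
        refine Finset.sum_le_sum fun m _ => ?_
        have hγ : ∀ γ ∈ contours Λ x i m, gint β κ Λ ((contourEvent γ).indicator 1) (plusConfig d)
            ≤ ENNReal.ofReal (2 * Real.exp (-(2 * β * m))) * Z := by
          intro γ hγ
          obtain ⟨-, hcard, B, hB, rfl⟩ := Finset.mem_filter.1 hγ
          rw [← hcard]
          exact gint_contourEvent_le hβ hκ hratio hdev hB
        refine (Finset.sum_le_card_nsmul _ _ _ hγ).trans ?_
        rw [nsmul_eq_mul, ← mul_assoc]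
        refine mul_le_mul_left ?_ _
        rw [← ENNReal.ofReal_natCast, ← ENNReal.ofReal_mul (by positivity)]
        refine ENNReal.ofReal_le_ofReal (mul_le_mul_of_nonneg_right ?_ (by positivity))
        exact_mod_cast card_contours_le Λ x i m
    _ ≤ _ := by
        rw [← Finset.sum_mul, ← ENNReal.ofReal_sum_of_nonneg (fun m _ => ht0 m)]
        exact mul_le_mul_left (ENNReal.ofReal_le_ofReal hsum) _

lemma lintegral_finiteGibbs_le {β κ : ℝ} (hβ : 0 ≤ β) (hκ : 0 < κ) (Λ : Finset (Site d))
    (η : Config d) {f : Config d → ℝ≥0∞} (hf : Measurable f) {c : ℝ≥0∞}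
    (h : gint β κ Λ f η ≤ c * gint β κ Λ 1 η) : ∫⁻ S, f S ∂finiteGibbs β κ Λ η ≤ c := by
  rw [lintegral_finiteGibbs β κ Λ η hf]
  refine (mul_le_mul_right h _).trans (le_of_eq ?_)
  rw [mul_left_comm, ENNReal.inv_mul_cancel (gint_one_ne_zero β κ Λ η)
    (gint_one_ne_top hβ hκ Λ η), mul_one]

/-- For parameters in the regime of the theorem, the finite-volume Gibbs measures with plus boundary
conditions are concentrated near the plus phase, uniformly in the volume. -/
lemma exists_threshold (hd : 2 ≤ d) {ε : ℝ} (hε : 0 < ε) :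
    ∃ c : ℝ, 0 < c ∧ ∀ β κ : ℝ, c < β → c < κ → c < κ / β → ∀ (n : ℕ) (x : Site d),
      ∫⁻ S, {S | sigma S x = -1}.indicator 1 S ∂finiteGibbs β κ (box d n) (plusConfig d)
          ≤ ENNReal.ofReal ε ∧
      ∫⁻ S, ENNReal.ofReal ((phi S x - 1) ^ 2) ∂finiteGibbs β κ (box d n) (plusConfig d)
          ≤ ENNReal.ofReal ε := by
  set K : ℕ := d * 3 ^ d with hK
  set b : ℝ := 2 + 256 * (d : ℝ) ^ 2 with hb
  have hbpos : 0 < b := by positivity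
  -- one summand of the threshold for each smallness condition below
  refine ⟨1 + 64 * (d : ℝ) ^ 2 + 40 * b + 4 * b / ε + 2 * (K : ℝ) ^ 2 + 32 / ε, by positivity, ?_⟩
  set c : ℝ := 1 + 64 * (d : ℝ) ^ 2 + 40 * b + 4 * b / ε + 2 * (K : ℝ) ^ 2 + 32 / ε with hc
  have hp1 : 0 ≤ 64 * (d : ℝ) ^ 2 := by positivity
  have hp2 : 0 ≤ 4 * b / ε := by positivity
  have hp3 : 0 ≤ 2 * (K : ℝ) ^ 2 := by positivity
  have hp4 : 0 ≤ 32 / ε := by positivity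
  intro β κ hcβ hcκ hcr n x
  have hc1 : 1 ≤ c := by linarith
  have hcpos : 0 < c := by linarith
  have hβ : 0 < β := by linarith
  have hκ : 0 < κ := by linarith
  have hbκ : β / κ ≤ 1 / c := by
    rw [lt_div_iff₀ hβ] at hcr
    rw [div_le_div_iff₀ hκ hcpos]
    linarith
  have hD : couplingRatio d β κ ≤ 8 * d / c := by
    have h0 : 0 ≤ β / κ := by positivity
    have h1 : (β / κ) ^ 2 ≤ 1 / c := by
      calc (β / κ) ^ 2 ≤ (1 / c) ^ 2 := by gcongr
        _ = 1 / c * (1 / c) := sq _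
        _ ≤ 1 / c * 1 := by
            gcongr
            rw [div_le_one hcpos]
            exact hc1
        _ = 1 / c := mul_one _
    calc couplingRatio d β κ = 8 * d * (β / κ) ^ 2 := by rw [couplingRatio]; ring
      _ ≤ 8 * d * (1 / c) := by gcongr
      _ = _ := by ring
  have hratio : 4 * d * couplingRatio d β κ ≤ 1 / 2 := by
    calc 4 * d * couplingRatio d β κ ≤ 4 * d * (8 * d / c) := by gcongr
      _ = 32 * (d : ℝ) ^ 2 / c := by ring
      _ ≤ 1 / 2 := by
          rw [div_le_iff₀ hcpos]
          linarith
  have hdb : devBound d β κ ≤ b / c := by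
    have h1 : 2 / κ ≤ 2 / c := by gcongr
    calc devBound d β κ = 2 / κ + 32 * d * couplingRatio d β κ := rfl
      _ ≤ 2 / c + 32 * d * (8 * d / c) := by gcongr
      _ = b / c := by rw [hb]; ring
  have hbc : b / c ≤ 1 / 40 := by
    rw [div_le_iff₀ hcpos]
    linarith
  have hbε : b / c ≤ ε / 4 := by
    rw [div_le_iff₀ hcpos]
    have : ε / 4 * (4 * b / ε) = b := by field_simp
    nlinarith
  have hexp : Real.exp (-(2 * β)) ≤ 1 / (2 * c) := by
    rw [Real.exp_neg, ← one_div]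
    have := Real.add_one_le_exp (2 * β)
    gcongr
    linarith
  have hexpε : Real.exp (-(2 * β)) ≤ ε / 64 := by
    refine hexp.trans ?_
    rw [div_le_iff₀ (by positivity)]
    have : ε / 64 * (2 * (32 / ε)) = 1 := by field_simp; norm_num
    nlinarith
  have hcount : 2 * (K : ℝ) ^ 2 * Real.exp (-(2 * β)) ≤ 1 / 2 := by
    calc 2 * (K : ℝ) ^ 2 * Real.exp (-(2 * β)) ≤ 2 * (K : ℝ) ^ 2 * (1 / (2 * c)) := by gcongr
      _ ≤ 1 / 2 := by
          rw [mul_one_div, div_le_iff₀ (by positivity)]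
          linarith
  have hmeas : Measurable ({S : Config d | sigma S x = -1}.indicator (1 : Config d → ℝ≥0∞)) :=
    measurable_one.indicator (measurableSet_sigma_eq x _)
  have hspin : ∫⁻ S, {S | sigma S x = -1}.indicator 1 S ∂finiteGibbs β κ (box d n) (plusConfig d)
      ≤ ENNReal.ofReal (4 * Real.exp (-(2 * β))) :=
    lintegral_finiteGibbs_le hβ.le hκ _ _ hmeas
      (gint_sigma_eq_neg_one_le hd hβ hκ hratio (by linarith) hcount n x)
  have hdevint : ∫⁻ S, ENNReal.ofReal (dev S x ^ 2) ∂finiteGibbs β κ (box d n) (plusConfig d)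
      ≤ ENNReal.ofReal (devBound d β κ) := by
    refine lintegral_finiteGibbs_le hβ.le hκ _ _ (by fun_prop) ?_
    have := gint_dev_sq_le hβ.le hκ hratio (box d n) (g := 1) measurable_one
      (fun _ _ _ => rfl) (fun _ => le_rfl) x
    simpa [devBound] using this
  refine ⟨hspin.trans (ENNReal.ofReal_le_ofReal (by linarith)), ?_⟩
  have hpt : ∀ S : Config d, ENNReal.ofReal ((phi S x - 1) ^ 2)
      ≤ ENNReal.ofReal 2 * ENNReal.ofReal (dev S x ^ 2)
        + ENNReal.ofReal 8 * {S | sigma S x = -1}.indicator 1 S := by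
    intro S
    rcases Int.units_eq_one_or (sigma S x) with h | h
    · have h1 : phi S x - 1 = dev S x := by simp [dev, h]
      rw [h1]
      refine le_add_right (le_mul_of_one_le_left' ?_)
      norm_num
    · have h1 : phi S x - 1 = dev S x - 2 := by simp [dev, h]; ring
      have h2 : {S : Config d | sigma S x = -1}.indicator (1 : Config d → ℝ≥0∞) S = 1 := by
        simp [h]
      rw [h1, h2, mul_one, ← ENNReal.ofReal_mul (by norm_num), ← ENNReal.ofReal_add
        (by positivity) (by norm_num)]
      refine ENNReal.ofReal_le_ofReal ?_
      nlinarith [sq_nonneg (dev S x + 2)]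
  calc ∫⁻ S, ENNReal.ofReal ((phi S x - 1) ^ 2) ∂finiteGibbs β κ (box d n) (plusConfig d)
      ≤ ∫⁻ S, (ENNReal.ofReal 2 * ENNReal.ofReal (dev S x ^ 2)
        + ENNReal.ofReal 8 * {S | sigma S x = -1}.indicator 1 S)
          ∂finiteGibbs β κ (box d n) (plusConfig d) := lintegral_mono hpt
    _ ≤ ENNReal.ofReal 2 * ENNReal.ofReal (devBound d β κ)
        + ENNReal.ofReal 8 * ENNReal.ofReal (4 * Real.exp (-(2 * β))) := by
        rw [lintegral_add_left (by fun_prop), lintegral_const_mul _ (by fun_prop),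
          lintegral_const_mul _ hmeas]
        gcongr
    _ ≤ ENNReal.ofReal ε := by
        have hδ0 : 0 ≤ devBound d β κ := by
          unfold devBound couplingRatio
          positivity
        rw [← ENNReal.ofReal_mul (by norm_num), ← ENNReal.ofReal_mul (by norm_num),
          ← ENNReal.ofReal_add (by positivity) (by positivity)]
        refine ENNReal.ofReal_le_ofReal ?_
        linarith

/-! ### Symmetries of the Gibbs kernels -/

@[fun_prop]
lemma measurable_shift (a : Site d) : Measurable (shift a) :=
  measurable_pi_lambda _ fun y => measurable_pi_apply (y - a)

lemma shift_shift (a b : Site d) (S : Config d) : shift a (shift b S) = shift (a + b) S := by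
  ext y : 1
  simp only [shift, sub_sub]

lemma energy_shift (β κ : ℝ) (Λ : Finset (Site d)) (a : Site d) (S : Config d) :
    energy β κ Λ (shift a S) = energy β κ (Λ.image fun x => x - a) S := by
  have hinj : ∀ s : Set (Site d), Set.InjOn (fun x => x - a) s := fun s =>
    (sub_left_injective (b := a)).injOn
  have hb : ∀ i : Fin d, bondBases (Λ.image fun x => x - a) i
      = (bondBases Λ i).image fun x => x - a := by
    intro i
    simp only [bondBases, Finset.image_union, Finset.image_image, Function.comp_def,
      sub_right_comm]
  unfold energy
  simp only [hb, Finset.sum_image (hinj _)]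
  have h : ∀ (x y : Site d), x - a + y = x + y - a := fun x y => by abel
  simp only [h]
  rfl

lemma gint_shift (β κ : ℝ) (Λ : Finset (Site d)) (a : Site d) {f : Config d → ℝ≥0∞}
    (hf : Measurable f) (η : Config d) :
    gint β κ Λ f (shift a η) = gint β κ (Λ.image fun x => x - a) (fun S => f (shift a S)) η := by
  have hm : Measurable fun S => f S * boltz β κ Λ S := hf.mul (measurable_boltz β κ Λ)
  have := lmarginal_image (X := fun _ : Site d => Spin) (μ := fun _ => aPriori)
    (e := fun x : Site d => x - a) (sub_left_injective (b := a)) Λ hm η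
  refine this.symm.trans ?_
  unfold gint
  congr 1
  ext S
  change f (shift a S) * boltz β κ Λ (shift a S) = _
  rw [boltz, energy_shift]
  rfl

lemma lintegral_finiteGibbs_shift (β κ : ℝ) (Λ : Finset (Site d)) (a : Site d)
    {f : Config d → ℝ≥0∞} (hf : Measurable f) (η : Config d) :
    ∫⁻ S, f S ∂finiteGibbs β κ Λ (shift a η)
      = ∫⁻ S, f (shift a S) ∂finiteGibbs β κ (Λ.image fun x => x - a) η := by
  rw [lintegral_finiteGibbs _ _ _ _ hf, gint_shift _ _ _ _ hf, gint_shift _ _ _ _ measurable_one]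
  exact (lintegral_finiteGibbs _ _ _ _ (hf.comp (measurable_shift a))).symm

lemma lintegral_finiteGibbs_flip (β κ : ℝ) (Λ : Finset (Site d)) {f : Config d → ℝ≥0∞}
    (hf : Measurable f) (η : Config d) :
    ∫⁻ S, f S ∂finiteGibbs β κ Λ (flipOn Set.univ η)
      = ∫⁻ S, f (flipOn Set.univ S) ∂finiteGibbs β κ Λ η := by
  have h : ∀ {f : Config d → ℝ≥0∞}, Measurable f →
      gint β κ Λ f (flipOn Set.univ η) = gint β κ Λ (fun S => f (flipOn Set.univ S)) η := by
    intro f hf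
    have hm : Measurable fun S => f S * boltz β κ Λ S := hf.mul (measurable_boltz β κ Λ)
    refine (lmarginal_comp_flipOn Set.univ Λ hm η).symm.trans ?_
    unfold gint
    congr 1
    ext S
    simp only [boltz, energy_flipOn_univ]
  rw [lintegral_finiteGibbs _ _ _ _ hf, h hf, h measurable_one]
  exact (lintegral_finiteGibbs _ _ _ _ (hf.comp (measurable_flipOn _))).symm

/-- A transformation that intertwines two Gibbs kernels maps invariant measures to invariant
measures. -/
lemma KernelInvariant.map {β κ : ℝ} {Λ Λ' : Finset (Site d)} {μ : Measure (Config d)}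
    (h : KernelInvariant β κ Λ' μ) {T : Config d → Config d} (hT : Measurable T)
    (hint : ∀ f : Config d → ℝ≥0∞, Measurable f → ∀ η,
      ∫⁻ S, f S ∂finiteGibbs β κ Λ (T η) = ∫⁻ S, f (T S) ∂finiteGibbs β κ Λ' η) :
    KernelInvariant β κ Λ (μ.map T) := by
  intro f hf
  rw [lintegral_map (measurable_lintegral_finiteGibbs β κ Λ hf) hT, lintegral_map hf hT]
  simp only [hint f hf]
  exact h _ (hf.comp hT)

/-! ### Averages over translations -/

/-- The finite-volume Gibbs measure in the box `[-2n, 2n]^d` with plus boundary conditions, averaged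
over the translations in `[-n, n]^d`. -/
def averaged (d : ℕ) (β κ : ℝ) (n : ℕ) : Measure (Config d) :=
  ((box d n).card : ℝ≥0∞)⁻¹ •
    ∑ a ∈ box d n, (finiteGibbs β κ (box d (2 * n)) (plusConfig d)).map (shift a)

lemma lintegral_averaged (β κ : ℝ) (n : ℕ) {f : Config d → ℝ≥0∞} (hf : Measurable f) :
    ∫⁻ S, f S ∂averaged d β κ n = ((box d n).card : ℝ≥0∞)⁻¹ *
      ∑ a ∈ box d n, ∫⁻ S, f (shift a S) ∂finiteGibbs β κ (box d (2 * n)) (plusConfig d) := by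
  rw [averaged, lintegral_smul_measure, lintegral_finsetSum_measure, smul_eq_mul]
  congr 1
  exact Finset.sum_congr rfl fun a _ => lintegral_map hf (measurable_shift a)

lemma card_box (n : ℕ) : (box d n).card = (2 * n + 1) ^ d := by
  rw [box, Pi.card_Icc]
  have : (Finset.Icc (-(n : ℤ)) n).card = 2 * n + 1 := by
    rw [Int.card_Icc]
    omega
  rw [Finset.prod_congr rfl fun _ _ => this]
  simp

lemma card_box_ne_zero (n : ℕ) : ((box d n).card : ℝ≥0∞) ≠ 0 := by
  rw [card_box]
  positivity

lemma lintegral_averaged_le (β κ : ℝ) (n : ℕ) {f : Config d → ℝ≥0∞} (hf : Measurable f) {c : ℝ≥0∞}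
    (h : ∀ a, ∫⁻ S, f (shift a S) ∂finiteGibbs β κ (box d (2 * n)) (plusConfig d) ≤ c) :
    ∫⁻ S, f S ∂averaged d β κ n ≤ c := by
  rw [lintegral_averaged _ _ _ hf]
  calc ((box d n).card : ℝ≥0∞)⁻¹ *
      ∑ a ∈ box d n, ∫⁻ S, f (shift a S) ∂finiteGibbs β κ (box d (2 * n)) (plusConfig d)
      ≤ ((box d n).card : ℝ≥0∞)⁻¹ * ((box d n).card * c) := by
        gcongr
        refine (Finset.sum_le_card_nsmul _ _ c fun a _ => h a).trans (le_of_eq ?_)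
        rw [nsmul_eq_mul]
    _ = c := by
        rw [← mul_assoc, ENNReal.inv_mul_cancel (card_box_ne_zero n) (by simp), one_mul]

lemma isProbabilityMeasure_averaged {β κ : ℝ} (hβ : 0 ≤ β) (hκ : 0 < κ) (n : ℕ) :
    IsProbabilityMeasure (averaged d β κ n) := by
  have := isProbabilityMeasure_finiteGibbs (d := d) hβ hκ
  constructor
  rw [← lintegral_one, lintegral_averaged _ _ _ measurable_const]
  simp only [lintegral_one, measure_univ, Finset.sum_const, nsmul_eq_mul, mul_one]
  exact ENNReal.inv_mul_cancel (card_box_ne_zero n) (by simp)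

lemma mem_box {n : ℕ} {x : Site d} : x ∈ box d n ↔ ∀ i, |x i| ≤ (n : ℤ) := by
  have := (notMem_box (d := d) (n := n) (x := x)).not
  push Not at this
  exact this

lemma exists_subset_box (Λ : Finset (Site d)) : ∃ n, Λ ⊆ box d n := by
  refine ⟨∑ x ∈ Λ, ∑ i, (x i).natAbs, fun x hx => mem_box.2 fun i => ?_⟩
  have h1 : (x i).natAbs ≤ ∑ i, (x i).natAbs :=
    Finset.single_le_sum (f := fun i => (x i).natAbs) (fun _ _ => Nat.zero_le _) (Finset.mem_univ i)
  have h2 : ∑ i, (x i).natAbs ≤ ∑ x ∈ Λ, ∑ i, (x i).natAbs :=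
    Finset.single_le_sum (f := fun x : Site d => ∑ i, (x i).natAbs) (fun _ _ => Nat.zero_le _) hx
  rw [Int.abs_eq_natAbs]
  exact_mod_cast h1.trans h2

lemma kernelInvariant_averaged {β κ : ℝ} (hβ : 0 ≤ β) (hκ : 0 < κ) {Λ : Finset (Site d)} {n : ℕ}
    (h : Λ ⊆ box d n) : KernelInvariant β κ Λ (averaged d β κ n) := by
  intro f hf
  rw [lintegral_averaged _ _ _ hf,
    lintegral_averaged _ _ _ (measurable_lintegral_finiteGibbs β κ Λ hf)]
  congr 1
  refine Finset.sum_congr rfl fun a ha => ?_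
  have hsub : Λ.image (fun x => x - a) ⊆ box d (2 * n) := by
    intro y hy
    obtain ⟨x, hx, rfl⟩ := Finset.mem_image.1 hy
    have hx' := mem_box.1 (h hx)
    have ha' := mem_box.1 ha
    refine mem_box.2 fun i => (abs_sub _ _).trans ?_
    have := hx' i
    have := ha' i
    push_cast
    linarith
  simp only [lintegral_finiteGibbs_shift β κ Λ a hf]
  exact lintegral_finiteGibbs_comp hβ hκ hsub (hf.comp (measurable_shift a)) _

/-- Translates of a large box differ little from it. -/
lemma card_image_sdiff_box_le (b : Site d) {k n : ℕ} (hb : b ∈ box d k) (hkn : k ≤ n) :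
    ((((box d n).image fun a => b + a) \ box d n).card : ℝ)
      ≤ d * (2 * k / (2 * n + 1)) * (box d n).card := by
  set I := (box d n).image fun a => b + a with hI
  have hsub : box d (n - k) ⊆ I ∩ box d n := by
    intro x hx
    have hx' := mem_box.1 hx
    have hb' := mem_box.1 hb
    push_cast [hkn] at hx'
    rw [Finset.mem_inter, hI, Finset.mem_image]
    refine ⟨⟨x - b, mem_box.2 fun i => (abs_sub _ _).trans ?_, by abel⟩, mem_box.2 fun i => ?_⟩
    · have := hx' i
      have := hb' i
      linarith
    · have := hx' i
      linarith
  have hcard : I.card = (box d n).card :=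
    Finset.card_image_of_injective _ (add_right_injective b)
  have h1 : (I \ box d n).card + (I ∩ box d n).card = (box d n).card := by
    rw [Finset.card_sdiff_add_card_inter, hcard]
  have h2 := Finset.card_le_card hsub
  have h3 : ((I \ box d n).card : ℝ) ≤ (box d n).card - (box d (n - k)).card := by
    have h1' : ((I \ box d n).card : ℝ) + (I ∩ box d n).card = (box d n).card := by
      exact_mod_cast h1
    have h2' : ((box d (n - k)).card : ℝ) ≤ (I ∩ box d n).card := by exact_mod_cast h2
    linarith
  refine h3.trans ?_
  rw [card_box, card_box]
  push_cast [hkn]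
  have hpos : (0 : ℝ) < 2 * n + 1 := by positivity
  have hkn' : (k : ℝ) ≤ n := by exact_mod_cast hkn
  set t : ℝ := 2 * k / (2 * n + 1) with ht
  have ht2 : t ≤ 2 := by
    rw [ht, div_le_iff₀ hpos]
    linarith
  have hbern := one_add_mul_le_pow (show -2 ≤ -t by linarith) d
  have hfac : (2 * ((n : ℝ) - k) + 1) = (2 * n + 1) * (1 + -t) := by
    rw [ht]
    field_simp
    ring
  rw [hfac, mul_pow]
  have := mul_le_mul_of_nonneg_left hbern (show (0 : ℝ) ≤ (2 * n + 1) ^ d by positivity)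
  linarith

/-- The averaged measures are almost invariant under any given translation. -/
lemma lintegral_averaged_shift_le {β κ : ℝ} (hβ : 0 ≤ β) (hκ : 0 < κ) (b : Site d) {k n : ℕ}
    (hb : b ∈ box d k) (hkn : k ≤ n) {f : Config d → ℝ≥0∞} (hf : Measurable f) {c : ℝ≥0∞}
    (hc : ∀ S, f S ≤ c) :
    ∫⁻ S, f (shift b S) ∂averaged d β κ n
      ≤ ∫⁻ S, f S ∂averaged d β κ n + ENNReal.ofReal (d * (2 * k / (2 * n + 1))) * c := by
  have hfb : Measurable fun S => f (shift b S) := hf.comp (measurable_shift b)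
  rw [lintegral_averaged _ _ _ hf, lintegral_averaged _ _ _ hfb]
  have hprob := isProbabilityMeasure_finiteGibbs (d := d) hβ hκ
  set F : Site d → ℝ≥0∞ := fun a =>
    ∫⁻ S, f (shift a S) ∂finiteGibbs β κ (box d (2 * n)) (plusConfig d) with hF
  have hFc : ∀ a, F a ≤ c := fun a =>
    (lintegral_mono fun S => hc _).trans (by simp)
  simp only [shift_shift]
  have hsum : ∑ a ∈ box d n, F (b + a)
      ≤ ∑ a ∈ box d n, F a + ENNReal.ofReal (d * (2 * k / (2 * n + 1)) * (box d n).card) * c := by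
    rw [← Finset.sum_image (f := F) ((add_right_injective b).injOn),
      ← Finset.sum_inter_add_sum_sdiff ((box d n).image fun a => b + a) (box d n) F]
    refine add_le_add (Finset.sum_le_sum_of_subset Finset.inter_subset_right) ?_
    refine (Finset.sum_le_card_nsmul _ _ c fun a _ => hFc a).trans ?_
    rw [nsmul_eq_mul, ← ENNReal.ofReal_natCast]
    exact mul_le_mul_left (ENNReal.ofReal_le_ofReal (card_image_sdiff_box_le b hb hkn)) _
  calc ((box d n).card : ℝ≥0∞)⁻¹ * ∑ a ∈ box d n, F (b + a)
      ≤ ((box d n).card : ℝ≥0∞)⁻¹ * (∑ a ∈ box d n, F a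
        + ENNReal.ofReal (d * (2 * k / (2 * n + 1)) * (box d n).card) * c) := by gcongr
    _ = _ := by
        rw [mul_add, ENNReal.ofReal_mul (by positivity), ENNReal.ofReal_natCast]
        congr 1
        rw [mul_comm (ENNReal.ofReal _) ((box d n).card : ℝ≥0∞), mul_assoc, ← mul_assoc,
          ENNReal.inv_mul_cancel (card_box_ne_zero n) (by simp), one_mul]

/-! ### Tightness and the Feller property -/

/-- Configurations whose fields have uniformly bounded second moments form a tight family. -/
lemma isTightMeasureSet_of_moment {c : ℝ} (hc : 0 < c) {A : Set (Measure (Config d))}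
    (hA : ∀ μ ∈ A, ∀ x, ∫⁻ S, ENNReal.ofReal ((phi S x - 1) ^ 2) ∂μ ≤ ENNReal.ofReal c) :
    IsTightMeasureSet A := by
  rw [isTightMeasureSet_iff_exists_isCompact_measure_compl_le]
  intro δ hδ
  obtain ⟨δ', hpos, hsum⟩ := ENNReal.exists_pos_sum_of_countable' hδ.ne' (Site d)
  have hfin : ∀ x, δ' x ≠ ∞ := fun x =>
    (((ENNReal.le_tsum x).trans_lt hsum).trans_le le_top).ne
  let t : Site d → ℝ≥0∞ := fun x => ENNReal.ofReal c / δ' x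
  have hc0 : ENNReal.ofReal c ≠ 0 := by simpa using hc
  have ht0 : ∀ x, t x ≠ 0 := fun x => ENNReal.div_ne_zero.2 ⟨hc0, hfin x⟩
  have httop : ∀ x, t x ≠ ∞ := fun x => ENNReal.div_ne_top ENNReal.ofReal_ne_top (hpos x).ne'
  let R : Site d → ℝ := fun x => √(t x).toReal
  refine ⟨Set.univ.pi fun x => Set.Icc (1 - R x) (1 + R x) ×ˢ Set.univ,
    isCompact_univ_pi fun x => isCompact_Icc.prod isCompact_univ, fun μ hμ => ?_⟩
  have hsub : (Set.univ.pi fun x => Set.Icc (1 - R x) (1 + R x) ×ˢ (Set.univ : Set ℤˣ))ᶜ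
      ⊆ ⋃ x, {S : Config d | t x ≤ ENNReal.ofReal ((phi S x - 1) ^ 2)} := by
    intro S hS
    simp only [Set.mem_compl_iff, Set.mem_pi, Set.mem_univ, true_implies, not_forall] at hS
    obtain ⟨x, hx⟩ := hS
    refine Set.mem_iUnion.2 ⟨x, ?_⟩
    by_contra h
    refine hx ⟨?_, trivial⟩
    rw [Set.mem_ofPred_eq, not_le] at h
    have h1 : (phi S x - 1) ^ 2 < (t x).toReal := by
      rw [ENNReal.ofReal_lt_iff_lt_toReal (sq_nonneg _) (httop x)] at h
      exact h
    have h2 : |phi S x - 1| ≤ R x := Real.abs_le_sqrt h1.le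
    rw [abs_le] at h2
    exact ⟨by change _ ≤ phi S x; linarith, by change phi S x ≤ _; linarith⟩
  calc μ _ ≤ μ (⋃ x, {S : Config d | t x ≤ ENNReal.ofReal ((phi S x - 1) ^ 2)}) :=
        measure_mono hsub
    _ ≤ ∑' x, μ {S : Config d | t x ≤ ENNReal.ofReal ((phi S x - 1) ^ 2)} := measure_iUnion_le _
    _ ≤ ∑' x, δ' x := by
        refine ENNReal.tsum_le_tsum fun x => ?_
        refine (meas_ge_le_lintegral_div (by fun_prop) (ht0 x) (httop x)).trans ?_
        refine (ENNReal.div_le_div_right (hA μ hμ x) _).trans (le_of_eq ?_)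
        simp only [t]
        rw [ENNReal.div_div_cancel hc0 ENNReal.ofReal_ne_top]
    _ ≤ δ := hsum.le

lemma continuous_phi (x : Site d) : Continuous fun S : Config d => phi S x :=
  continuous_fst.comp (continuous_apply x)

lemma continuous_sigma (x : Site d) : Continuous fun S : Config d => sigma S x :=
  continuous_snd.comp (continuous_apply x)

lemma continuous_boltz (β κ : ℝ) (Λ : Finset (Site d)) : Continuous (boltz (d := d) β κ Λ) := by
  have hφ := continuous_phi (d := d)
  have hσ : ∀ x, Continuous fun S : Config d => ((sigma S x : ℤ) : ℝ) := fun x =>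
    (continuous_of_discreteTopology (f := fun u : ℤˣ => ((u : ℤ) : ℝ))).comp (continuous_sigma x)
  have hE : Continuous fun S : Config d => Real.exp (-energy β κ Λ S) := by
    unfold energy
    fun_prop
  exact ENNReal.continuous_ofReal.comp hE

lemma continuous_updateFinset_left (Λ : Finset (Site d)) (s : Λ → Spin) :
    Continuous fun η : Config d => Function.updateFinset η Λ s := by
  refine continuous_pi fun x => ?_
  by_cases hx : x ∈ Λ
  · simp only [Function.updateFinset, hx, dif_pos]
    exact continuous_const
  · simp only [Function.updateFinset, hx, dif_neg, not_false_eq_true]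
    exact continuous_apply x

/-- Unnormalised Gibbs integrals of bounded continuous functions depend continuously on the boundary
condition. -/
lemma continuous_gint {β κ : ℝ} (hβ : 0 ≤ β) (hκ : 0 < κ) (Λ : Finset (Site d))
    {f : Config d → NNReal} (hf : Continuous f) {C : NNReal} (hC : ∀ S, f S ≤ C) :
    Continuous (gint β κ Λ fun S => (f S : ℝ≥0∞)) := by
  rw [continuous_iff_continuousAt]
  intro η
  have hm : Measurable fun S : Config d => (f S : ℝ≥0∞) * boltz β κ Λ S :=
    hf.measurable.coe_nnreal_ennreal.mul (measurable_boltz β κ Λ)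
  have hsb : Measurable fun S : Config d => ∏ x ∈ Λ, siteBound κ (S x) :=
    Finset.measurable_fun_prod _ fun x _ => (measurable_siteBound κ).comp (measurable_pi_apply x)
  refine tendsto_lintegral_filter_of_dominated_convergence
    (fun s => (C : ℝ≥0∞) * ∏ x ∈ Λ, siteBound κ (Function.updateFinset η Λ s x)) ?_ ?_ ?_ ?_
  · exact Filter.Eventually.of_forall fun η' => hm.comp measurable_updateFinset
  · refine Filter.Eventually.of_forall fun η' => Filter.Eventually.of_forall fun s => ?_
    dsimp only
    refine mul_le_mul' (by exact_mod_cast hC _) ?_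
    have h1 := prod_mul_boltz_le (κ := κ) hβ Λ (Function.updateFinset η' Λ s)
    have h2 : ∏ x ∈ Λ, siteBound κ (Function.updateFinset η' Λ s x)
        = ∏ x ∈ Λ, siteBound κ (Function.updateFinset η Λ s x) :=
      Finset.prod_congr rfl fun x hx => by simp [Function.updateFinset, hx]
    rw [← h2]
    refine le_trans (le_mul_of_one_le_left' ?_) h1
    rw [ENNReal.one_le_ofReal]
    exact one_le_prod_one_add_sq Λ _
  · have hsb' : Measurable fun s : Λ → Spin =>
        ∏ x ∈ Λ, siteBound κ (Function.updateFinset η Λ s x) := hsb.comp measurable_updateFinset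
    rw [lintegral_const_mul _ hsb']
    exact ENNReal.mul_ne_top (by simp) (lmarginal_prod_siteBound_lt_top hκ Λ η).ne
  · refine Filter.Eventually.of_forall fun s => ?_
    have h1 : Filter.Tendsto (fun η' : Config d => Function.updateFinset η' Λ s) (nhds η)
        (nhds (Function.updateFinset η Λ s)) := (continuous_updateFinset_left Λ s).tendsto η
    refine ENNReal.Tendsto.mul ?_ (Or.inr ENNReal.ofReal_ne_top) ?_ (Or.inr ENNReal.coe_ne_top)
    · exact ENNReal.tendsto_coe.2 ((hf.tendsto _).comp h1)
    · exact ((continuous_boltz β κ Λ).tendsto _).comp h1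

/-- The Feller property of the Gibbs kernels. -/
lemma exists_boundedContinuous_eq_lintegral {β κ : ℝ} (hβ : 0 ≤ β) (hκ : 0 < κ)
    (Λ : Finset (Site d)) (f : BoundedContinuousFunction (Config d) NNReal) :
    ∃ h : BoundedContinuousFunction (Config d) NNReal,
      ∀ η, (h η : ℝ≥0∞) = ∫⁻ S, f S ∂finiteGibbs β κ Λ η := by
  have hprob := isProbabilityMeasure_finiteGibbs (d := d) hβ hκ
  set C : NNReal := nndist f 0 with hCdef
  have hC : ∀ S, f S ≤ C := BoundedContinuousFunction.NNReal.upper_bound f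
  have hle : ∀ η, ∫⁻ S, f S ∂finiteGibbs β κ Λ η ≤ C := fun η =>
    (lintegral_mono fun S => ENNReal.coe_le_coe.2 (hC S)).trans (by simp)
  have hne : ∀ η, ∫⁻ S, f S ∂finiteGibbs β κ Λ η ≠ ∞ := fun η =>
    ((hle η).trans_lt ENNReal.coe_lt_top).ne
  have hcont : Continuous fun η => ∫⁻ S, f S ∂finiteGibbs β κ Λ η := by
    simp only [lintegral_finiteGibbs β κ Λ _ f.continuous.measurable.coe_nnreal_ennreal]
    have hZ : Continuous (gint (d := d) β κ Λ 1) := by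
      have := continuous_gint (d := d) hβ hκ Λ (f := fun _ => 1) continuous_const (fun _ => le_rfl)
      simpa only [ENNReal.coe_one] using! this
    rw [continuous_iff_continuousAt]
    intro η
    refine ENNReal.Tendsto.mul ((hZ.inv).tendsto η) (Or.inl ?_)
      ((continuous_gint hβ hκ Λ f.continuous hC).tendsto η) (Or.inr ?_)
    · exact ENNReal.inv_ne_zero.2 (gint_one_ne_top hβ hκ Λ η)
    · exact ENNReal.inv_ne_top.2 (gint_one_ne_zero β κ Λ η)
  refine ⟨BoundedContinuousFunction.mkOfBound
    ⟨fun η => (∫⁻ S, f S ∂finiteGibbs β κ Λ η).toNNReal, ?_⟩ C fun η η' => ?_, fun η => ?_⟩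
  · rw [continuous_iff_continuousAt]
    exact fun η => (ENNReal.tendsto_toNNReal (hne η)).comp (hcont.tendsto η)
  · have h1 : ∀ η, (∫⁻ S, f S ∂finiteGibbs β κ Λ η).toNNReal ≤ C := fun η =>
      (ENNReal.toNNReal_mono ENNReal.coe_ne_top (hle η)).trans_eq (ENNReal.toNNReal_coe C)
    have h2 : ((∫⁻ S, f S ∂finiteGibbs β κ Λ η).toNNReal : ℝ) ≤ C := h1 η
    have h3 : ((∫⁻ S, f S ∂finiteGibbs β κ Λ η').toNNReal : ℝ) ≤ C := h1 η'
    rw [NNReal.dist_eq, abs_le]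
    constructor
    · have := ((∫⁻ S, f S ∂finiteGibbs β κ Λ η).toNNReal).coe_nonneg
      change -(C : ℝ) ≤ ((∫⁻ S, f S ∂finiteGibbs β κ Λ η).toNNReal : ℝ)
        - ((∫⁻ S, f S ∂finiteGibbs β κ Λ η').toNNReal : ℝ)
      linarith
    · have := ((∫⁻ S, f S ∂finiteGibbs β κ Λ η').toNNReal).coe_nonneg
      change ((∫⁻ S, f S ∂finiteGibbs β κ Λ η).toNNReal : ℝ)
        - ((∫⁻ S, f S ∂finiteGibbs β κ Λ η').toNNReal : ℝ) ≤ C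
      linarith
  · exact ENNReal.coe_toNNReal (hne η)

/-- To be preserved by a Gibbs kernel, it is enough to be so for bounded continuous functions. -/
lemma kernelInvariant_of_boundedContinuous {β κ : ℝ}
    (Λ : Finset (Site d)) (μ : Measure (Config d)) [IsProbabilityMeasure μ]
    (h : ∀ f : BoundedContinuousFunction (Config d) NNReal,
      ∫⁻ η, (∫⁻ S, f S ∂finiteGibbs β κ Λ η) ∂μ = ∫⁻ S, f S ∂μ) :
    KernelInvariant β κ Λ μ := by
  have hmeas : Measurable fun η : Config d => finiteGibbs β κ Λ η := by
    refine Measure.measurable_of_measurable_coe _ fun A hA => ?_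
    simp only [← lintegral_indicator_one hA]
    exact measurable_lintegral_finiteGibbs β κ Λ (measurable_one.indicator hA)
  have hbind : ∀ f : Config d → ℝ≥0∞, Measurable f →
      ∫⁻ S, f S ∂(μ.bind fun η => finiteGibbs β κ Λ η)
        = ∫⁻ η, (∫⁻ S, f S ∂finiteGibbs β κ Λ η) ∂μ := fun f hf =>
    Measure.lintegral_bind hmeas.aemeasurable hf.aemeasurable
  have heq : μ = μ.bind fun η => finiteGibbs β κ Λ η := by
    refine ext_of_forall_lintegral_eq_of_IsFiniteMeasure fun f => ?_
    rw [hbind _ f.continuous.measurable.coe_nnreal_ennreal, h f]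
  intro f hf
  rw [← hbind f hf, ← heq]

/-! ### Infinite-volume limit -/

/-- Bounds on integrals of continuous nonnegative functions pass to weak limits. -/
lemma lintegral_le_of_tendsto {Ω ι : Type*} [MeasurableSpace Ω] [TopologicalSpace Ω]
    [OpensMeasurableSpace Ω] {F : Filter ι} [F.NeBot] {ν : ι → ProbabilityMeasure Ω}
    {μ : ProbabilityMeasure Ω} (hν : Filter.Tendsto ν F (nhds μ)) {g : Ω → NNReal}
    (hg : Continuous g) {c : ℝ≥0∞} (h : ∀ i, ∫⁻ ω, g ω ∂(ν i : Measure Ω) ≤ c) :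
    ∫⁻ ω, g ω ∂(μ : Measure Ω) ≤ c := by
  rw [ProbabilityMeasure.tendsto_iff_forall_lintegral_tendsto] at hν
  -- truncate `g` at height `k`
  have htrunc : ∀ k : ℕ, ∫⁻ ω, ((min (g ω) k : NNReal) : ℝ≥0∞) ∂(μ : Measure Ω) ≤ c := by
    intro k
    let gk : BoundedContinuousFunction Ω NNReal := BoundedContinuousFunction.mkOfBound
      ⟨fun ω => min (g ω) k, hg.min continuous_const⟩ k fun x y => by
        have h1 : ((min (g x) k : NNReal) : ℝ) ≤ k := by
          exact_mod_cast min_le_right (g x) (k : NNReal)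
        have h2 : ((min (g y) k : NNReal) : ℝ) ≤ k := by
          exact_mod_cast min_le_right (g y) (k : NNReal)
        have h3 := (min (g x) (k : NNReal)).coe_nonneg
        have h4 := (min (g y) (k : NNReal)).coe_nonneg
        change dist (min (g x) (k : NNReal)) (min (g y) (k : NNReal)) ≤ k
        rw [NNReal.dist_eq, abs_le]
        constructor <;> linarith
    refine le_of_tendsto (hν gk) (Filter.Eventually.of_forall fun i => ?_)
    refine (lintegral_mono fun ω => ?_).trans (h i)
    exact ENNReal.coe_le_coe.2 (min_le_left (g ω) (k : NNReal))
  have hlim : Filter.Tendsto (fun k : ℕ => ∫⁻ ω, ((min (g ω) k : NNReal) : ℝ≥0∞) ∂(μ : Measure Ω))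
      Filter.atTop (nhds (∫⁻ ω, g ω ∂(μ : Measure Ω))) := by
    refine lintegral_tendsto_of_tendsto_of_monotone
      (fun k => (hg.min continuous_const).measurable.coe_nnreal_ennreal.aemeasurable) ?_ ?_
    · refine Filter.Eventually.of_forall fun ω k l hkl => ?_
      exact ENNReal.coe_le_coe.2 (min_le_min le_rfl (by exact_mod_cast hkl))
    · refine Filter.Eventually.of_forall fun ω => ?_
      obtain ⟨N, hN⟩ := exists_nat_ge (g ω)
      refine tendsto_const_nhds.congr' ?_
      filter_upwards [Filter.eventually_ge_atTop N] with k hk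
      rw [min_eq_left (hN.trans (by exact_mod_cast hk))]
  exact le_of_tendsto' hlim htrunc

lemma tendsto_boundary_ratio (d k : ℕ) (C : NNReal) :
    Filter.Tendsto (fun n : ℕ => ENNReal.ofReal (d * (2 * k / (2 * n + 1))) * (C : ℝ≥0∞))
      Filter.atTop (nhds 0) := by
  have h1 : Filter.Tendsto (fun n : ℕ => (d * (2 * k / (2 * n + 1)) : ℝ)) Filter.atTop
      (nhds 0) := by
    have h2 : Filter.Tendsto (fun n : ℕ => (2 * n + 1 : ℝ)) Filter.atTop Filter.atTop :=
      Filter.tendsto_atTop_add_const_right _ _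
        (tendsto_natCast_atTop_atTop.const_mul_atTop two_pos)
    simpa using (h2.const_div_atTop (2 * k : ℝ)).const_mul (d : ℝ)
  have h3 := ENNReal.tendsto_ofReal h1
  rw [ENNReal.ofReal_zero] at h3
  simpa using ENNReal.Tendsto.mul_const h3 (Or.inr (ENNReal.coe_ne_top (r := C)))

/-- A measure that does not increase integrals of bounded continuous functions under translations is
translation-invariant. -/
lemma translationInvariant_of_le (μ : Measure (Config d)) [IsProbabilityMeasure μ]
    (h : ∀ (b : Site d) (f : BoundedContinuousFunction (Config d) NNReal),
      ∫⁻ S, f (shift b S) ∂μ ≤ ∫⁻ S, f S ∂μ) : TranslationInvariant μ := by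
  intro b
  have hcont : ∀ b : Site d, Continuous (shift b : Config d → Config d) := fun b =>
    continuous_pi fun y => continuous_apply (y - b)
  symm
  refine ext_of_forall_lintegral_eq_of_IsFiniteMeasure fun f => ?_
  rw [lintegral_map f.continuous.measurable.coe_nnreal_ennreal (measurable_shift b)]
  refine le_antisymm ?_ (h b f)
  have := h (-b) (f.compContinuous ⟨shift b, hcont b⟩)
  refine le_trans (le_of_eq (lintegral_congr fun S => ?_)) this
  change (f S : ℝ≥0∞) = f (shift b (shift (-b) S))
  rw [shift_shift, add_neg_cancel]
  congr 2
  ext y : 1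
  simp [shift]

/-- The plus phase, as a limit along an ultrafilter of the averaged finite-volume measures. -/
lemma exists_plus_phase (hd : 2 ≤ d) {ε : ℝ} (hε : 0 < ε) :
    ∃ c : ℝ, 0 < c ∧ ∀ β κ : ℝ, c < β → c < κ → c < κ / β →
      ∃ μ : Measure (Config d), IsProbabilityMeasure μ ∧
        (∀ Λ : Finset (Site d), KernelInvariant β κ Λ μ) ∧ TranslationInvariant μ ∧
        ∀ x, μ {S | sigma S x = -1} ≤ ENNReal.ofReal ε ∧
          ∫⁻ S, ENNReal.ofReal ((phi S x - 1) ^ 2) ∂μ ≤ ENNReal.ofReal ε := by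
  obtain ⟨c, hc, hbound⟩ := exists_threshold (d := d) hd hε
  refine ⟨c, hc, fun β κ hcβ hcκ hcr => ?_⟩
  have hβ : 0 ≤ β := by linarith
  have hκ : 0 < κ := by linarith
  have hfinite := fun n => hbound β κ hcβ hcκ hcr (2 * n)
  let ν : ℕ → ProbabilityMeasure (Config d) := fun n =>
    ⟨averaged d β κ n, isProbabilityMeasure_averaged hβ hκ n⟩
  have hspin : ∀ n x, ∫⁻ S, {S | sigma S x = -1}.indicator 1 S ∂averaged d β κ n
      ≤ ENNReal.ofReal ε := by
    intro n x
    refine lintegral_averaged_le β κ n (measurable_one.indicator (measurableSet_sigma_eq x _))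
      fun a => ?_
    exact (hfinite n (x - a)).1
  have hmoment : ∀ n x, ∫⁻ S, ENNReal.ofReal ((phi S x - 1) ^ 2) ∂averaged d β κ n
      ≤ ENNReal.ofReal ε := by
    intro n x
    refine lintegral_averaged_le β κ n (by fun_prop) fun a => ?_
    exact (hfinite n (x - a)).2
  have htight : IsTightMeasureSet {m | ∃ μ ∈ Set.range ν, (μ : Measure (Config d)) = m} := by
    refine isTightMeasureSet_of_moment hε ?_
    rintro _ ⟨_, ⟨n, rfl⟩, rfl⟩ x
    exact hmoment n x
  obtain ⟨μ, -, hμ⟩ := (isCompact_closure_of_isTightMeasureSet htight).ultrafilter_le_nhds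
    ((Filter.hyperfilter ℕ).map ν) (by
      rw [Ultrafilter.coe_map, Filter.le_principal_iff, Filter.mem_map]
      exact Filter.Eventually.of_forall fun n => subset_closure ⟨n, rfl⟩)
  have hlim : Filter.Tendsto ν (Filter.hyperfilter ℕ : Filter ℕ) (nhds μ) := hμ
  have hlim' := ProbabilityMeasure.tendsto_iff_forall_lintegral_tendsto.1 hlim
  have hat : ∀ {p : ℕ → Prop}, (∀ᶠ n in Filter.atTop, p n) →
      ∀ᶠ n in (Filter.hyperfilter ℕ : Filter ℕ), p n := fun h => Nat.hyperfilter_le_atTop h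
  refine ⟨μ, inferInstance, fun Λ => ?_, ?_, fun x => ⟨?_, ?_⟩⟩
  · refine kernelInvariant_of_boundedContinuous Λ _ fun f => ?_
    obtain ⟨h, hh⟩ := exists_boundedContinuous_eq_lintegral hβ hκ Λ f
    simp only [← hh]
    obtain ⟨n₀, hn₀⟩ := exists_subset_box Λ
    refine tendsto_nhds_unique ((hlim' h).congr' ?_) (hlim' f)
    refine hat ?_
    filter_upwards [Filter.eventually_ge_atTop n₀] with n hn
    simp only [hh]
    refine kernelInvariant_averaged hβ hκ (hn₀.trans fun x hx => mem_box.2 fun i => ?_) _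
      f.continuous.measurable.coe_nnreal_ennreal
    exact (mem_box.1 hx i).trans (by exact_mod_cast hn)
  · refine translationInvariant_of_le _ fun b f => ?_
    obtain ⟨k, hk⟩ := exists_subset_box {b}
    rw [Finset.singleton_subset_iff] at hk
    have hcont : Continuous (shift b : Config d → Config d) :=
      continuous_pi fun y => continuous_apply (y - b)
    have h1 := hlim' (f.compContinuous ⟨shift b, hcont⟩)
    have h2 := (hlim' f).add
      ((tendsto_boundary_ratio d k (nndist f 0)).mono_left Nat.hyperfilter_le_atTop)
    rw [add_zero] at h2
    refine le_of_tendsto_of_tendsto h1 h2 (hat ?_)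
    filter_upwards [Filter.eventually_ge_atTop k] with n hn
    exact lintegral_averaged_shift_le hβ hκ b hk hn f.continuous.measurable.coe_nnreal_ennreal
      fun S => ENNReal.coe_le_coe.2 (BoundedContinuousFunction.NNReal.upper_bound f S)
  · let g : Config d → NNReal := fun S => if sigma S x = -1 then 1 else 0
    have hg : Continuous g :=
      (continuous_of_discreteTopology (f := fun u : ℤˣ => if u = -1 then (1 : NNReal) else 0)).comp
        (continuous_sigma x)
    have hgi : ∀ S, (g S : ℝ≥0∞) = {S : Config d | sigma S x = -1}.indicator 1 S := by
      intro S
      by_cases h : sigma S x = -1 <;> simp [g, h]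
    have := lintegral_le_of_tendsto hlim hg (c := ENNReal.ofReal ε) fun n => by
      simp only [hgi]
      exact hspin n x
    simp only [hgi] at this
    rwa [lintegral_indicator_one (measurableSet_sigma_eq x _)] at this
  · refine lintegral_le_of_tendsto hlim (g := fun S => Real.toNNReal ((phi S x - 1) ^ 2)) ?_
      fun n => hmoment n x
    exact continuous_real_toNNReal.comp (((continuous_phi x).sub continuous_const).pow 2)

end GaussianDoubleWell

end

open GaussianDoubleWell

theorem mainTheorem7 (d : ℕ) (hd : 2 ≤ d) (ε : ℝ) (hε : 0 < ε) :
    ∃ c : ℝ, 0 < c ∧ ∀ β κ : ℝ, c < β → c < κ → c < κ / β →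
      ∃ μp μm : Measure (GaussianDoubleWell.Config d),
        (GaussianDoubleWell.IsGibbs β κ μp ∧ GaussianDoubleWell.IsGibbs β κ μm) ∧
        (GaussianDoubleWell.TranslationInvariant μp ∧
          GaussianDoubleWell.TranslationInvariant μm) ∧
        μp ≠ μm ∧
        (∀ x : GaussianDoubleWell.Site d,
          1 - ε ≤ μp.real {S | GaussianDoubleWell.sigma S x = 1} ∧
          1 - ε ≤ μm.real {S | GaussianDoubleWell.sigma S x = -1}) ∧
        (∀ x : GaussianDoubleWell.Site d,
          (Integrable (fun S => (GaussianDoubleWell.phi S x - 1) ^ 2) μp ∧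
            ∫ S, (GaussianDoubleWell.phi S x - 1) ^ 2 ∂μp ≤ ε) ∧
          (Integrable (fun S => (GaussianDoubleWell.phi S x + 1) ^ 2) μm ∧
            ∫ S, (GaussianDoubleWell.phi S x + 1) ^ 2 ∂μm ≤ ε)) := by
  -- with `δ < 1 / 2` the two phases are certainly distinct
  set δ : ℝ := min ε (1 / 4) with hδ
  have hδpos : 0 < δ := lt_min hε (by norm_num)
  have hδε : δ ≤ ε := min_le_left _ _
  have hδ4 : δ ≤ 1 / 4 := min_le_right _ _
  obtain ⟨c, hc, hphase⟩ := exists_plus_phase (d := d) hd hδpos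
  refine ⟨c, hc, fun β κ hcβ hcκ hcr => ?_⟩
  have hβ : 0 ≤ β := by linarith
  have hκ : 0 < κ := by linarith
  obtain ⟨μ, hprob, hinv, htrans, hbound⟩ := hphase β κ hcβ hcκ hcr
  set T : Config d → Config d := flipOn Set.univ with hT
  have hTm : Measurable T := measurable_flipOn _
  have hTphi : ∀ S x, phi (T S) x = -phi S x := fun S x => by simp [hT, phi, flipOn, flipSpin]
  have hTsigma : ∀ S x, sigma (T S) x = -sigma S x := fun S x => by
    simp [hT, sigma, flipOn, flipSpin]
  have hprobm : IsProbabilityMeasure (μ.map T) := Measure.isProbabilityMeasure_map hTm.aemeasurable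
  have hplus : ∀ x, 1 - δ ≤ μ.real {S | sigma S x = 1} := by
    intro x
    have hcompl : {S : Config d | sigma S x = 1} = {S | sigma S x = -1}ᶜ := by
      ext S
      simp only [Set.mem_ofPred_eq, Set.mem_compl_iff]
      rcases Int.units_eq_one_or (sigma S x) with h | h <;> rw [h] <;> decide
    rw [hcompl, probReal_compl_eq_one_sub (measurableSet_sigma_eq x _)]
    have : μ.real {S | sigma S x = -1} ≤ δ :=
      ENNReal.toReal_le_of_le_ofReal hδpos.le (hbound x).1
    linarith
  have hminus : ∀ x, 1 - δ ≤ (μ.map T).real {S | sigma S x = -1} := by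
    intro x
    rw [map_measureReal_apply hTm (measurableSet_sigma_eq x _)]
    have : T ⁻¹' {S | sigma S x = -1} = {S | sigma S x = 1} := by
      ext S
      simp [hTsigma]
    rw [this]
    exact hplus x
  have hint : ∀ x, Integrable (fun S => (phi S x - 1) ^ 2) μ := by
    intro x
    have hm : Measurable fun S : Config d => (phi S x - 1) ^ 2 := by fun_prop
    refine ⟨hm.aestronglyMeasurable, ?_⟩
    rw [hasFiniteIntegral_iff_ofReal (Filter.Eventually.of_forall fun S => sq_nonneg _)]
    exact (hbound x).2.trans_lt ENNReal.ofReal_lt_top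
  have hval : ∀ x, ∫ S, (phi S x - 1) ^ 2 ∂μ ≤ δ := by
    intro x
    rw [integral_eq_lintegral_of_nonneg_ae (Filter.Eventually.of_forall fun S => sq_nonneg _)
      (hint x).aestronglyMeasurable]
    exact ENNReal.toReal_le_of_le_ofReal hδpos.le (hbound x).2
  have hflip : ∀ S x, (phi (T S) x + 1) ^ 2 = (phi S x - 1) ^ 2 := fun S x => by
    rw [hTphi]
    ring
  have hmm : ∀ x, AEStronglyMeasurable (fun S : Config d => (phi S x + 1) ^ 2) (μ.map T) := by
    intro x
    have hm : Measurable fun S : Config d => (phi S x + 1) ^ 2 := by fun_prop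
    exact hm.aestronglyMeasurable
  refine ⟨μ, μ.map T, ⟨isGibbs_of_kernelInvariant hβ hκ μ hinv,
    isGibbs_of_kernelInvariant hβ hκ _ fun Λ => (hinv Λ).map hTm fun f hf η =>
      lintegral_finiteGibbs_flip β κ Λ hf η⟩, ⟨htrans, fun a => ?_⟩, fun heq => ?_,
    fun x => ⟨by linarith [hplus x], by linarith [hminus x]⟩,
    fun x => ⟨⟨hint x, (hval x).trans hδε⟩, ?_, ?_⟩⟩
  · rw [Measure.map_map (measurable_shift a) hTm]
    have hcomm : shift a ∘ T = T ∘ shift a := by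
      ext S y : 2
      simp [shift, hT, flipOn]
    rw [hcomm, ← Measure.map_map hTm (measurable_shift a), htrans a]
  · have h1 := hplus 0
    have h2 := hminus 0
    rw [← heq] at h2
    have hdisj : Disjoint {S : Config d | sigma S 0 = 1} {S | sigma S 0 = -1} := by
      rw [Set.disjoint_left]
      intro S hS hS'
      rw [Set.mem_ofPred_eq] at hS hS'
      rw [hS] at hS'
      exact absurd hS' (by decide)
    have h3 := measureReal_union (μ := μ) hdisj (measurableSet_sigma_eq 0 _)
    have h4 : μ.real ({S : Config d | sigma S 0 = 1} ∪ {S | sigma S 0 = -1}) ≤ 1 :=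
      measureReal_le_one
    linarith
  · rw [integrable_map_measure (hmm x) hTm.aemeasurable]
    simp only [Function.comp_def, hflip]
    exact hint x
  · rw [integral_map hTm.aemeasurable (hmm x)]
    simp only [hflip]
    exact (hval x).trans hδε
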